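/- Let $k\ge 1$ be a fixed integer. For $0\le m\le 2^k\binom nk$ let $\mathcal P^{\rm sat}_{n,m}$ be the distribution of the random $k$-CNF formula $F$ over the variables $x_1,\dots,x_n$ obtained as follows: order all $2^k\binom nk$ clauses on $k$ distinct variables uniformly at random, start from the empty formula, scan the first $m$ clauses in this order, and include each scanned clause if and only if the formula remains satisfiable after adding it. A variable is frozen in $F$ if it takes the same value in all satisfying assignments of $F$. The formula induced by the non-frozen variables is obtained from $F$ by setting every frozen variable to its frozen value, removing all clauses that contain a true literal, and deleting the false literals from the other clauses; its connected components are those of the graph on the variables in which two distinct variables are adjacent if and only if some clause contains both. There are constants $c=c(k)>0$ and $\alpha=\alpha(k)>0$ such that for every sequence $m=m(n)$ with $c\le m/n$ and $m\le 2^k\binom nk$ for all sufficiently large $n$, with probability tending to $1$ as $n\to\infty$ the formula $F$ drawn from $\mathcal P^{\rm sat}_{n,m}$ has all of the following properties. 1. At most $e^{-\alpha m/n}\,n$ variables are not frozen. 2. Every connected component of the formula induced by the non-frozen variables has at most $\log n$ variables. 3. The number $\beta(F)$ of satisfying assignments of $F$ satisfies $\beta(F)\ge 1$ and $\frac1n\log\beta(F)\le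 e^{-\alpha m/n}$. -/

import Mathlib

open Filter Topology

namespace KSat

/-- A literal over the variables `x_0, …, x_{n-1}`: `(x, true)` is the variable `x` itself and
`(x, false)` is its negation. -/
abbrev Literal (n : ℕ) : Type := Fin n × Bool

/-- A truth assignment to the `n` variables. -/
abbrev Assignment (n : ℕ) : Type := Fin n → Bool

/-- A CNF formula: a finite set of clauses, each clause being a finite set of literals. -/
abbrev Formula (n : ℕ) : Type := Finset (Finset (Literal n))

/-- The literal `l` evaluates to TRUE under `φ`. -/
def LitTrue {n : ℕ} (φ : Assignment n) (l : Literal n) : Prop := φ l.1 = l.2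

/-- The assignment `φ` satisfies the formula `F`: every clause contains a TRUE literal. -/
def Satisfies {n : ℕ} (φ : Assignment n) (F : Formula n) : Prop :=
  ∀ C ∈ F, ∃ l ∈ C, LitTrue φ l

/-- Some assignment satisfies `F`. -/
def Satisfiable {n : ℕ} (F : Formula n) : Prop := ∃ φ : Assignment n, Satisfies φ F

/-- The clauses over `n` variables with exactly `k` literals, on `k` distinct variables;
there are `2 ^ k * n.choose k` of them. -/
abbrev KClause (k n : ℕ) : Type :=
  {C : Finset (Literal n) // C.card = k ∧ (C.image Prod.fst).card = k}

/-- The orderings (permutations) of all `k`-clauses over `n` variables. -/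
abbrev ClauseOrder (k n : ℕ) : Type := Fin (Fintype.card (KClause k n)) ≃ KClause k n

instance (k n : ℕ) : Nonempty (ClauseOrder k n) := ⟨(Fintype.equivFin (KClause k n)).symm⟩

open Classical in
/-- One step of the process: the scanned clause is included iff the formula stays satisfiable. -/
noncomputable def addClause {n : ℕ} (F : Formula n) (C : Finset (Literal n)) : Formula n :=
  if Satisfiable (insert C F) then insert C F else F

/-- The formula obtained from the empty formula by scanning the first `m` clauses in the
order `σ`. -/
noncomputable def satProcess {k n : ℕ} (m : ℕ) (σ : ClauseOrder k n) : Formula n :=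
  (((List.ofFn σ).take m).map Subtype.val).foldl addClause ∅

/-- The distribution of the random satisfiable formula: scan the first `m` clauses of a
uniformly random ordering of all `k`-clauses over `n` variables. -/
noncomputable def Psat (k n m : ℕ) : PMF (Formula n) :=
  (PMF.uniformOfFintype (ClauseOrder k n)).map (satProcess m)

/-- The variable `x` takes the same value in all satisfying assignments of `F`. -/
def Frozen {n : ℕ} (F : Formula n) (x : Fin n) : Prop :=
  ∀ φ ψ : Assignment n, Satisfies φ F → Satisfies ψ F → φ x = ψ x

/-- `β(F)`: the number of satisfying assignments of `F`. -/
noncomputable def numSat {n : ℕ} (F : Formula n) : ℕ :=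
  {φ : Assignment n | Satisfies φ F}.ncard

open Classical in
/-- Set the variables in `A` according to `φ` and simplify `F`: remove every clause that
contains a TRUE literal on a variable of `A`, and remove the FALSE literals on variables of `A`
from the other clauses. -/
noncomputable def residual {n : ℕ} (F : Formula n) (A : Set (Fin n)) (φ : Assignment n) :
    Formula n :=
  (F.filter fun C => ¬ ∃ l ∈ C, l.1 ∈ A ∧ LitTrue φ l).image
    fun C => C.filter fun l => ¬ (l.1 ∈ A ∧ ¬ LitTrue φ l)

/-- The graph of a formula: the vertices are the variables, and two variables are adjacent iff
some clause contains them both. -/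
def formulaGraph {n : ℕ} (F : Formula n) : SimpleGraph (Fin n) where
  Adj x y := x ≠ y ∧ ∃ C ∈ F, (∃ l ∈ C, l.1 = x) ∧ ∃ l ∈ C, l.1 = y
  symm := ⟨fun _ _ h => ⟨h.1.symm, let ⟨C, hC, hx, hy⟩ := h.2; ⟨C, hC, hy, hx⟩⟩⟩
  loopless := ⟨fun _ h => h.1 rfl⟩

end KSat

namespace KSat

/-! ### The scanning process and clauses that freeze a variable -/

section Scanning

variable {k n : ℕ}

/-! A scanned clause that is true under some satisfying assignment of the final formula cannot have
been rejected, so a rejected clause is false under all of them. Hence, if every literal of a scanned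
clause except the one on `x` is already false under all satisfying assignments, then `x` is frozen:
acceptance makes its literal true, rejection makes it false (`frozen_of_forcing`). An unfrozen
variable therefore means that the random order has avoided a whole set of clauses, and avoiding a
set of density `β` for `m` steps has probability at most `exp (-β * m)`.

Two stages use this. After linearly many clauses, fewer than a quarter of the variables are unfrozen
(`prob_le_card_unfrozen_le`). Otherwise, comparing one satisfying assignment with all others gives
an assignment and a set of variables for which a set of clauses of constant density was avoided; a
union bound over these `4 ^ n` pairs rules this out. From then on, a set `S` of unfrozen variables
has about `|S| / n` times the number `N` of all clauses as forcing clauses, so it survives with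
probability exponentially small in `|S| * m / n`. This remains true when the clauses at a few
positions are prescribed, at a cost of about `2 / N` each (`prob_pinned_unfrozen_le`).

A union bound over sets `S` bounds the number of unfrozen variables. A component with more than `log
n` variables contains an exploration along about `(log n) / k` scanned clauses, each finding a new
unfrozen variable. The number of explorations is bounded by `card_explorations_le`, and each added
clause contributes a factor of order `t * exp (-(4 * a * t))` with `t = m / n` and `a = rate k`,
which is small for dense formulas. The bound on satisfying assignments follows, since they are
determined by the unfrozen variables.

All estimates need `2 * m ≤ N`. For larger `m` and `k ≥ 2`, everything is typically frozen by
position `N / 2`, and freezing is monotone. -/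

theorem Satisfies.mono {φ : Assignment n} {F G : Formula n} (h : F ⊆ G) (hφ : Satisfies φ G) :
    Satisfies φ F := fun C hC => hφ C (h hC)

theorem Frozen.mono {F G : Formula n} {x : Fin n} (h : F ⊆ G) (hx : Frozen F x) : Frozen G x :=
  fun φ ψ hφ hψ => hx φ ψ (hφ.mono h) (hψ.mono h)

theorem subset_addClause (F : Formula n) (C : Finset (Literal n)) : F ⊆ addClause F C := by
  unfold addClause
  split_ifs
  · exact Finset.subset_insert _ _
  · exact subset_rfl

theorem satProcess_zero (σ : ClauseOrder k n) : satProcess 0 σ = ∅ := by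
  simp [satProcess]

theorem satProcess_succ {p : ℕ} (hp : p < Fintype.card (KClause k n)) (σ : ClauseOrder k n) :
    satProcess (p + 1) σ = addClause (satProcess p σ) (σ ⟨p, hp⟩).1 := by
  have hl : p < (List.ofFn σ).length := by simpa using hp
  unfold satProcess
  rw [List.take_succ_eq_append_getElem hl]
  simp

theorem satProcess_of_card_le {p : ℕ} (hp : Fintype.card (KClause k n) ≤ p)
    (σ : ClauseOrder k n) :
    satProcess (p + 1) σ = satProcess p σ := by
  have hl : (List.ofFn σ).length ≤ p := by simpa using hp
  unfold satProcess
  rw [List.take_of_length_le hl, List.take_of_length_le (by omega)]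

theorem satProcess_subset_succ (p : ℕ) (σ : ClauseOrder k n) :
    satProcess p σ ⊆ satProcess (p + 1) σ := by
  by_cases hp : p < Fintype.card (KClause k n)
  · rw [satProcess_succ hp]
    exact subset_addClause _ _
  · rw [satProcess_of_card_le (not_lt.1 hp)]

theorem satProcess_mono {p q : ℕ} (h : p ≤ q) (σ : ClauseOrder k n) :
    satProcess p σ ⊆ satProcess q σ :=
  monotone_nat_of_le_succ (f := fun p => satProcess p σ)
    (fun p => satProcess_subset_succ p σ) h

theorem satisfiable_satProcess (p : ℕ) (σ : ClauseOrder k n) : Satisfiable (satProcess p σ) := by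
  induction p with
  | zero => exact ⟨fun _ => true, by simp [satProcess_zero, Satisfies]⟩
  | succ p ih =>
    by_cases hp : p < Fintype.card (KClause k n)
    · rw [satProcess_succ hp]
      unfold addClause
      split_ifs with h
      · exact h
      · exact ih
    · rwa [satProcess_of_card_le (not_lt.1 hp)]

/-- This makes events about the first `p` steps local, as needed when an ordering is exposed
position by position. -/
theorem satProcess_congr {p : ℕ} {σ τ : ClauseOrder k n}
    (h : ∀ i : Fin (Fintype.card (KClause k n)), (i : ℕ) < p → σ i = τ i) :
    satProcess p σ = satProcess p τ := by
  induction p with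
  | zero => simp [satProcess_zero]
  | succ p ih =>
    have ih := ih fun i hi => h i (by omega)
    by_cases hp : p < Fintype.card (KClause k n)
    · rw [satProcess_succ hp, satProcess_succ hp, ih, h ⟨p, hp⟩ (by simp)]
    · rw [satProcess_of_card_le (not_lt.1 hp), satProcess_of_card_le (not_lt.1 hp), ih]

theorem exists_of_mem_satProcess {p : ℕ} {σ : ClauseOrder k n} {C : Finset (Literal n)}
    (h : C ∈ satProcess p σ) :
    ∃ i : Fin (Fintype.card (KClause k n)), (i : ℕ) < p ∧ (σ i).1 = C := by
  induction p with
  | zero => simp [satProcess_zero] at h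
  | succ p ih =>
    by_cases hp : p < Fintype.card (KClause k n)
    · rw [satProcess_succ hp] at h
      unfold addClause at h
      split_ifs at h
      · rcases Finset.mem_insert.1 h with h | h
        · exact ⟨⟨p, hp⟩, by simp, h.symm⟩
        · obtain ⟨i, hi, hC⟩ := ih h
          exact ⟨i, by omega, hC⟩
      · obtain ⟨i, hi, hC⟩ := ih h
        exact ⟨i, by omega, hC⟩
    · rw [satProcess_of_card_le (not_lt.1 hp)] at h
      obtain ⟨i, hi, hC⟩ := ih h
      exact ⟨i, by omega, hC⟩

/-- A scanned clause that holds under a satisfying assignment of the final formula has been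
included. -/
theorem mem_satProcess {p : ℕ} {σ : ClauseOrder k n} {φ : Assignment n}
    (hφ : Satisfies φ (satProcess p σ)) {i : Fin (Fintype.card (KClause k n))}
    (hi : (i : ℕ) < p) (hC : ∃ l ∈ (σ i).1, LitTrue φ l) : (σ i).1 ∈ satProcess p σ := by
  have h1 : (σ i).1 ∈ satProcess (i + 1) σ := by
    have hs := satProcess_succ i.2 σ
    rw [hs]
    unfold addClause
    rw [if_pos]
    · exact Finset.mem_insert_self _ _
    -- The assignment `φ` itself witnesses that the clause may be added at its own step, because the
    -- formula at that time is part of the final one.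
    · refine ⟨φ, fun C hC' => ?_⟩
      rcases Finset.mem_insert.1 hC' with rfl | h
      · exact hC
      · exact hφ C (satProcess_mono hi.le σ h)
  exact satProcess_mono hi σ h1

/-- The literals on the variables `J`, with signs given by `χ`. -/
def literalsOn (χ : Assignment n) (J : Finset (Fin n)) : Finset (Literal n) :=
  J.image fun y => (y, χ y)

/-- The clauses that contain the variable `x` and whose other literals are FALSE under every
satisfying assignment of `F`. -/
noncomputable def forcing (k : ℕ) {n : ℕ} (F : Formula n) (x : Fin n) :
    Finset (KClause k n) :=
  open Classical in
  Finset.univ.filter fun C => (∃ l ∈ C.1, l.1 = x) ∧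
    ∀ l ∈ C.1, l.1 ≠ x → ∀ φ, Satisfies φ F → ¬ LitTrue φ l

/-- Under satisfying assignments of the final formula the clause is equivalent to its literal on
`x`. If it was included, the literal is always true; if it was rejected, the literal is always
false. -/
theorem frozen_of_forcing {m₀ m : ℕ} (hm : m₀ ≤ m) {σ : ClauseOrder k n} {x : Fin n}
    {i : Fin (Fintype.card (KClause k n))} (hi : (i : ℕ) < m)
    (hC : σ i ∈ forcing k (satProcess m₀ σ) x) : Frozen (satProcess m σ) x := by
  classical
  obtain ⟨⟨l, hl, hlx⟩, hother⟩ := (Finset.mem_filter.1 hC).2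
  have huniq : ∀ l' ∈ (σ i).1, l'.1 = x → l' = l := by
    have hinj : Set.InjOn Prod.fst ((σ i).1 : Set (Literal n)) :=
      Finset.card_image_iff.1 ((σ i).2.2.trans (σ i).2.1.symm)
    exact fun l' hl' h => hinj hl' hl (h.trans hlx.symm)
  have key : ∀ φ, Satisfies φ (satProcess m σ) →
      ((∃ l' ∈ (σ i).1, LitTrue φ l') ↔ φ x = l.2) := by
    intro φ hφ
    constructor
    · rintro ⟨l', hl', ht⟩
      by_cases h : l'.1 = x
      · obtain rfl := huniq l' hl' h
        rw [← h]; exact ht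
      · exact absurd ht (hother l' hl' h φ (hφ.mono (satProcess_mono hm σ)))
    · intro h
      exact ⟨l, hl, by rw [LitTrue, hlx, h]⟩
  intro φ ψ hφ hψ
  by_cases hmem : (σ i).1 ∈ satProcess m σ
  · rw [(key φ hφ).1 (hφ _ hmem), (key ψ hψ).1 (hψ _ hmem)]
  · have h1 : φ x ≠ l.2 := fun h => hmem (mem_satProcess hφ hi ((key φ hφ).2 h))
    have h2 : ψ x ≠ l.2 := fun h => hmem (mem_satProcess hψ hi ((key ψ hψ).2 h))
    revert h1 h2
    cases φ x <;> cases ψ x <;> cases l.2 <;> simp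

end Scanning

/-! ### Counting clauses -/

section Counting

variable {k n : ℕ}

theorem card_literalsOn (χ : Assignment n) (J : Finset (Fin n)) :
    (literalsOn χ J).card = J.card :=
  Finset.card_image_of_injective _ fun _ _ h => congrArg Prod.fst h

theorem image_fst_literalsOn (χ : Assignment n) (J : Finset (Fin n)) :
    (literalsOn χ J).image Prod.fst = J := by
  simp [literalsOn, Finset.image_image, Function.comp_def]

/-- Lower bounds on sets of clauses need only one sign pattern: with `χ` fixed, distinct variable
sets give distinct clauses. -/
theorem card_le_card_of_literalsOn (B : Finset (KClause k n)) (𝒥 : Finset (Finset (Fin n)))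
    (χ : Assignment n) (hk : ∀ J ∈ 𝒥, J.card = k)
    (hB : ∀ J ∈ 𝒥, ∀ C : KClause k n, C.1 = literalsOn χ J → C ∈ B) : 𝒥.card ≤ B.card := by
  classical
  have h : 𝒥.image (literalsOn χ) ⊆ B.image Subtype.val := by
    intro D hD
    obtain ⟨J, hJ, rfl⟩ := Finset.mem_image.1 hD
    refine Finset.mem_image.2 ⟨⟨literalsOn χ J, ?_, ?_⟩, hB J hJ _ rfl, rfl⟩
    · rw [card_literalsOn, hk J hJ]
    · rw [image_fst_literalsOn, hk J hJ]
  have h1 := Finset.card_le_card h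
  rw [Finset.card_image_of_injective _ (fun I J hIJ => by
    rw [← image_fst_literalsOn χ I, hIJ, image_fst_literalsOn]),
    Finset.card_image_of_injective _ Subtype.val_injective] at h1
  exact h1

/-- The pair can be recovered from the union by intersecting with `S` and with `A`. -/
theorem card_image_insert {ι : Type*} [DecidableEq ι] {S A : Finset ι} (h : Disjoint S A)
    (j : ℕ) :
    ((S ×ˢ A.powersetCard j).image fun p => insert p.1 p.2).card = S.card * A.card.choose j := by
  rw [Finset.card_image_of_injOn, Finset.card_product, Finset.card_powersetCard]
  rintro ⟨x, I⟩ h1 ⟨y, J⟩ h2 hxy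
  simp only [Finset.coe_product, Set.mem_prod, Finset.mem_coe, Finset.mem_powersetCard] at h1 h2
  have hS : ∀ {z K}, z ∈ S → K ⊆ A → (insert z K) ∩ S = {z} ∧ (insert z K) ∩ A = K := by
    intro z K hz hK
    have h' := Finset.disjoint_left.1 h
    constructor
    · ext a
      simp only [Finset.mem_inter, Finset.mem_insert, Finset.mem_singleton]
      constructor
      · rintro ⟨rfl | h1, h2⟩
        · rfl
        · exact absurd (hK h1) (h' h2)
      · rintro rfl; exact ⟨Or.inl rfl, hz⟩
    · ext a
      simp only [Finset.mem_inter, Finset.mem_insert]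
      constructor
      · rintro ⟨rfl | h1, h2⟩
        · exact absurd h2 (h' hz)
        · exact h1
      · intro ha; exact ⟨Or.inr ha, hK ha⟩
  have e1 := hS h1.1 h1.2.1
  have e2 := hS h2.1 h2.2.1
  simp only at hxy
  rw [hxy] at e1
  have := e1.1.symm.trans e2.1
  rw [Finset.singleton_inj] at this
  rw [this, ← e1.2, e2.2]

theorem mem_literalsOn {χ : Assignment n} {J : Finset (Fin n)} {l : Literal n} :
    l ∈ literalsOn χ J ↔ l.1 ∈ J ∧ l.2 = χ l.1 := by
  rw [literalsOn, Finset.mem_image]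
  constructor
  · rintro ⟨y, hy, rfl⟩; exact ⟨hy, rfl⟩
  · rintro ⟨h1, h2⟩; exact ⟨l.1, h1, by rw [← h2]⟩

theorem card_kClause_le : Fintype.card (KClause k n) ≤ (2 * n).choose k := by
  classical
  have h : (Finset.univ.image (Subtype.val : KClause k n → _)) ⊆
      (Finset.univ : Finset (Literal n)).powersetCard k := by
    intro C hC
    obtain ⟨D, -, rfl⟩ := Finset.mem_image.1 hC
    exact Finset.mem_powersetCard.2 ⟨Finset.subset_univ _, D.2.1⟩
  have := Finset.card_le_card h
  rw [Finset.card_image_of_injective _ Subtype.val_injective, Finset.card_powersetCard] at this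
  simpa [Finset.card_univ, mul_comm n 2] using this

theorem choose_le_card_kClause : n.choose k ≤ Fintype.card (KClause k n) := by
  have := card_le_card_of_literalsOn (Finset.univ : Finset (KClause k n))
    ((Finset.univ : Finset (Fin n)).powersetCard k) (fun _ => true)
    (fun J hJ => (Finset.mem_powersetCard.1 hJ).2) (fun _ _ _ _ => Finset.mem_univ _)
  simpa using this

/-- The clauses that contain the variable `u`. -/
noncomputable def clausesAt (k : ℕ) {n : ℕ} (u : Fin n) : Finset (KClause k n) :=
  open Classical in Finset.univ.filter fun C => u ∈ C.1.image Prod.fst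

theorem card_clausesAt_le (u : Fin n) :
    (clausesAt k u).card ≤ 2 * (2 * n).choose (k - 1) := by
  classical
  have h : (clausesAt k u).image Subtype.val ⊆ (Finset.univ : Finset Bool).biUnion fun b =>
      ((Finset.univ : Finset (Literal n)).powersetCard (k - 1)).image (insert (u, b)) := by
    intro C hC
    obtain ⟨D, hD, rfl⟩ := Finset.mem_image.1 hC
    obtain ⟨⟨v, b⟩, hl, hv⟩ := Finset.mem_image.1 (Finset.mem_filter.1 hD).2
    obtain rfl : v = u := hv
    refine Finset.mem_biUnion.2 ⟨b, Finset.mem_univ _, Finset.mem_image.2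
      ⟨D.1.erase (v, b), Finset.mem_powersetCard.2 ⟨Finset.subset_univ _, ?_⟩,
        Finset.insert_erase hl⟩⟩
    rw [Finset.card_erase_of_mem hl, D.2.1]
  have h1 := Finset.card_le_card h
  rw [Finset.card_image_of_injective _ Subtype.val_injective] at h1
  refine h1.trans (Finset.card_biUnion_le.trans ?_)
  refine (Finset.sum_le_sum fun b _ => Finset.card_image_le).trans ?_
  simp [Finset.card_univ, mul_comm n 2]

theorem card_kClause_le_real :
    (Fintype.card (KClause k n) : ℝ) ≤ (2 * n : ℝ) ^ k / k.factorial := by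
  have h : (Fintype.card (KClause k n) : ℝ) ≤ ((2 * n).choose k : ℕ) := by
    exact_mod_cast card_kClause_le
  refine h.trans ?_
  have := Nat.choose_le_pow_div (α := ℝ) k (2 * n)
  push_cast at this
  exact this

theorem pow_div_le_choose {a : ℕ} {j : ℕ} {y : ℝ} (hy : 0 ≤ y) (h : y + j ≤ a) :
    y ^ j / j.factorial ≤ (a.choose j : ℝ) := by
  refine le_trans ?_ (Nat.pow_le_choose (α := ℝ) j a)
  have hj : j ≤ a + 1 := by
    have : (j : ℝ) ≤ a + 1 := by linarith
    exact_mod_cast this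
  push_cast [Nat.cast_sub hj]
  gcongr
  linarith

theorem le_card_kClause (hn : 2 * k ≤ n) :
    (n / 2 : ℝ) ^ k / k.factorial ≤ Fintype.card (KClause k n) := by
  have h : ((n.choose k : ℕ) : ℝ) ≤ Fintype.card (KClause k n) := by
    exact_mod_cast choose_le_card_kClause
  refine le_trans (pow_div_le_choose (by positivity) ?_) h
  have : (2 * k : ℝ) ≤ n := by exact_mod_cast hn
  linarith

/-- The total is at most `(2 * n) ^ k / k!`, while `a - k ≥ n / 4 - n / 8 = n / 8` gives at least
`(n / 8) ^ k / k!`; the ratio of the bases is `1 / 16`. -/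
theorem card_kClause_le_choose {a : ℕ} (hn : 8 * k ≤ n) (ha : n ≤ 4 * a) :
    (1 / 16 : ℝ) ^ k * Fintype.card (KClause k n) ≤ a.choose k := by
  have h1 : (8 * k : ℝ) ≤ n := by exact_mod_cast hn
  have h2 : (n : ℝ) ≤ 4 * a := by exact_mod_cast ha
  calc (1 / 16 : ℝ) ^ k * Fintype.card (KClause k n)
      ≤ (1 / 16 : ℝ) ^ k * ((2 * n : ℝ) ^ k / k.factorial) := by
        gcongr; exact card_kClause_le_real
    _ = (n / 8 : ℝ) ^ k / k.factorial := by
        rw [← mul_div_assoc, ← mul_pow]; congr 2; ring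
    _ ≤ _ := pow_div_le_choose (by positivity) (by linarith)

theorem card_kClause_le_mul_choose {a : ℕ} (hk : 1 ≤ k) (hn : 8 * k ≤ n) (ha : n ≤ 4 * a) :
    (1 / 16 : ℝ) ^ k * Fintype.card (KClause k n) ≤ n * a.choose (k - 1) := by
  have h1 : (8 * k : ℝ) ≤ n := by exact_mod_cast hn
  have h2 : (n : ℝ) ≤ 4 * a := by exact_mod_cast ha
  obtain ⟨j, rfl⟩ : ∃ j, k = j + 1 := ⟨k - 1, by omega⟩
  push_cast at h1
  simp only [Nat.add_sub_cancel]
  calc (1 / 16 : ℝ) ^ (j + 1) * Fintype.card (KClause (j + 1) n)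
      ≤ (1 / 16 : ℝ) ^ (j + 1) * ((2 * n : ℝ) ^ (j + 1) / (j + 1).factorial) := by
        gcongr; exact card_kClause_le_real
    _ = (n / 8 : ℝ) ^ (j + 1) / (j + 1).factorial := by
        rw [← mul_div_assoc, ← mul_pow]; congr 2; ring
    _ ≤ (n / 8 : ℝ) ^ (j + 1) / j.factorial := by
        gcongr; omega
    _ = (n / 8) * ((n / 8 : ℝ) ^ j / j.factorial) := by ring
    _ ≤ n * a.choose j := by
        gcongr
        · have : (0 : ℝ) ≤ n := by positivity
          linarith
        · exact pow_div_le_choose (by positivity) (by linarith)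

theorem card_clausesAt_le_real (hk : 1 ≤ k) (hn : 2 * k ≤ n) (u : Fin n) :
    ((clausesAt k u).card : ℝ) ≤ k * 4 ^ k * (Fintype.card (KClause k n) / n) := by
  have hn0 : (0 : ℝ) < n := by
    have : 0 < n := by omega
    exact_mod_cast this
  have h1 : ((clausesAt k u).card : ℝ) ≤ 2 * ((2 * n).choose (k - 1) : ℕ) := by
    exact_mod_cast card_clausesAt_le u
  have h2 := Nat.choose_le_pow_div (α := ℝ) (k - 1) (2 * n)
  have h3 := le_card_kClause (k := k) hn
  obtain ⟨j, rfl⟩ : ∃ j, k = j + 1 := ⟨k - 1, by omega⟩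
  simp only [Nat.add_sub_cancel] at h1 h2
  calc ((clausesAt (j + 1) u).card : ℝ) ≤ 2 * (((2 * n : ℕ) : ℝ) ^ j / j.factorial) := by
        linarith
    _ = ((j + 1 : ℕ) : ℝ) * 4 ^ (j + 1) *
          ((n / 2 : ℝ) ^ (j + 1) / (j + 1).factorial / n) := by
        rw [Nat.factorial_succ]
        push_cast
        rw [show (n / 2 : ℝ) ^ (j + 1) = n ^ (j + 1) / 2 ^ (j + 1) by rw [div_pow],
          show (4 : ℝ) ^ (j + 1) = 2 ^ (j + 1) * 2 ^ (j + 1) by rw [← mul_pow]; norm_num]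
        field_simp
        ring
    _ ≤ _ := by gcongr

end Counting

/-! ### Random orderings exposed one position at a time -/

section Orderings

variable {α : Type*} [Fintype α] {N : ℕ}

/-- The probability of an event under the uniform distribution on a finite type. -/
noncomputable def prob {Ω : Type*} [Fintype Ω] (E : Ω → Prop) : ℝ :=
  ({ω | E ω}.ncard : ℝ) / Fintype.card Ω

theorem prob_eq_card {Ω : Type*} [Fintype Ω] (E : Ω → Prop) [DecidablePred E] :
    prob E = ((Finset.univ.filter E).card : ℝ) / Fintype.card Ω := by
  rw [prob, Set.ncard_eq_toFinset_card', Set.toFinset_ofPred]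

theorem prob_le_one {Ω : Type*} [Fintype Ω] (E : Ω → Prop) : prob E ≤ 1 := by
  classical
  rw [prob_eq_card]
  exact div_le_one_of_le₀ (by exact_mod_cast Finset.card_le_univ _) (by positivity)

theorem prob_mono {Ω : Type*} [Fintype Ω] {E E' : Ω → Prop} (h : ∀ ω, E ω → E' ω) :
    prob E ≤ prob E' := by
  have h1 : {ω | E ω}.ncard ≤ {ω | E' ω}.ncard := Set.ncard_le_ncard h
  unfold prob
  gcongr

theorem prob_or_le {Ω : Type*} [Fintype Ω] (E E' : Ω → Prop) :
    prob (fun ω => E ω ∨ E' ω) ≤ prob E + prob E' := by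
  unfold prob
  rw [← add_div, Set.ofPred_or]
  gcongr
  exact_mod_cast Set.ncard_union_le _ _

theorem prob_exists_le {Ω ι : Type*} [Fintype Ω] (s : Finset ι) (E : ι → Ω → Prop) :
    prob (fun ω => ∃ i ∈ s, E i ω) ≤ ∑ i ∈ s, prob (E i) := by
  classical
  induction s using Finset.induction_on with
  | empty => simp [prob]
  | insert i s hi ih =>
    rw [Finset.sum_insert hi]
    refine le_trans (prob_mono fun ω h => ?_)
      ((prob_or_le (E i) _).trans (add_le_add_right ih _))
    simpa using h

theorem prob_exists_le_card_mul {Ω ι : Type*} [Fintype Ω] (s : Finset ι) (E : ι → Ω → Prop)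
    {b : ℝ} (h : ∀ i ∈ s, prob (E i) ≤ b) : prob (fun ω => ∃ i ∈ s, E i ω) ≤ s.card * b := by
  refine (prob_exists_le s E).trans ((Finset.sum_le_sum h).trans ?_)
  simp

/-- Double counting of pairs `(ω, j)`: for fixed `j`, the involution `f j` matches the relevant `ω`
with the elements of `A'`. -/
theorem sum_card_filter_involutive {Ω ι : Type*} [Fintype Ω] (A A' : Ω → Prop)
    [DecidablePred A] [DecidablePred A'] (J : Finset ι) (f : ι → Ω → Ω)
    (hf : ∀ j, Function.Involutive (f j)) (h : ∀ j ∈ J, ∀ ω, A' (f j ω) → A ω) :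
    ∑ ω ∈ Finset.univ.filter A, (J.filter fun j => A' (f j ω)).card =
      J.card * (Finset.univ.filter A').card := by
  refine (Finset.sum_card_bipartiteAbove_eq_sum_card_bipartiteBelow
    (fun ω j => A' (f j ω))).trans ?_
  refine Finset.sum_const_nat fun j hj => ?_
  refine Finset.card_bij' (fun ω _ => f j ω) (fun ω _ => f j ω) (fun ω hω => ?_)
    (fun ω hω => ?_) (fun ω _ => hf j ω) (fun ω _ => hf j ω)
  · simpa using (Finset.mem_filter.1 hω).2
  · have hω' : A' ω := (Finset.mem_filter.1 hω).2
    have h1 : A' (f j (f j ω)) := by rwa [hf j ω]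
    exact Finset.mem_filter.2 ⟨Finset.mem_filter.2 ⟨Finset.mem_univ _, h j hj _ h1⟩, h1⟩

/-- Exposing a uniformly random ordering one position at a time. -/
theorem prob_le_prod [DecidableEq α] (E : ℕ → (Fin N ≃ α) → Prop) (θ : ℕ → ℝ)
    {m : ℕ} (hm : m ≤ N) (hθ : ∀ p < m, 0 ≤ θ p)
    (hmono : ∀ p < m, ∀ σ, E (p + 1) σ → E p σ)
    (hlocal : ∀ p < m, ∀ σ τ : Fin N ≃ α, (∀ i : Fin N, (i : ℕ) < p → σ i = τ i) → E p σ → E p τ)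
    (hbranch : ∀ (p : ℕ) (hp : p < N), p < m → ∀ σ, E p σ → ∀ s : Finset (Fin N),
      (∀ j ∈ s, p ≤ (j : ℕ) ∧ E (p + 1) ((Equiv.swap ⟨p, hp⟩ j).trans σ)) →
      (s.card : ℝ) ≤ θ p * (N - p)) :
    prob (E m) ≤ ∏ p ∈ Finset.range m, θ p := by
  classical
  induction m with
  | zero => simpa using prob_le_one _
  | succ m ih =>
    have hmN : m < N := by omega
    have ih := ih (by omega) (fun p hp => hθ p (by omega)) (fun p hp => hmono p (by omega))
      (fun p hp => hlocal p (by omega)) (fun p hp hpm => hbranch p hp (by omega))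
    rw [Finset.prod_range_succ]
    -- Count pairs of an ordering in `E m` and a position `j ≥ m` whose swap with position `m` lands
    -- in `E (m + 1)`. Each ordering has at most `θ m * (N - m)` such `j`, and each `j` yields every
    -- element of `E (m + 1)` exactly once.
    suffices h : ((Finset.univ.filter (E (m + 1))).card : ℝ) * (N - m) ≤
        (Finset.univ.filter (E m)).card * (θ m * (N - m)) by
      have hpos : (0 : ℝ) < N - m := sub_pos.2 (by exact_mod_cast hmN)
      rw [← mul_assoc] at h
      have h' := le_of_mul_le_mul_right h hpos
      refine le_trans ?_ (mul_le_mul_of_nonneg_right ih (hθ m (by omega)))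
      rw [prob_eq_card, prob_eq_card, div_mul_eq_mul_div]
      gcongr
    set J : Finset (Fin N) := Finset.univ.filter fun j => m ≤ (j : ℕ) with hJ
    have hJcard : (J.card : ℝ) = N - m := by
      have : J.card = N - m := by
        have : J = Finset.Ici (⟨m, hmN⟩ : Fin N) := by
          ext j; simp [hJ, Fin.le_def]
        rw [this, Fin.card_Ici]
      rw [this, Nat.cast_sub hmN.le]
    have hswap : ∀ j ∈ J, ∀ σ : Fin N ≃ α, E m σ →
        E m ((Equiv.swap ⟨m, hmN⟩ j).trans σ) := by
      intro j hj σ hσ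
      refine hlocal m (by omega) σ _ (fun i hi => ?_) hσ
      have hj' : m ≤ (j : ℕ) := by simpa [hJ] using hj
      rw [Equiv.trans_apply, Equiv.swap_apply_of_ne_of_ne]
      · exact fun h => by simp [h] at hi
      · exact fun h => by rw [h] at hi; omega
    have hinv : ∀ j : Fin N, Function.Involutive
        fun σ : Fin N ≃ α => (Equiv.swap ⟨m, hmN⟩ j).trans σ := by
      intro j σ
      exact Equiv.ext fun i => by
        rw [Equiv.trans_apply, Equiv.trans_apply, Equiv.swap_apply_self]
    have hdouble := sum_card_filter_involutive (E m) (E (m + 1)) J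
      (fun j σ => (Equiv.swap ⟨m, hmN⟩ j).trans σ) hinv fun j hj σ hσ => by
        have := hswap j hj _ (hmono m (by omega) _ hσ)
        have h2 := hinv j σ
        simp only at h2
        rwa [h2] at this
    have hle : ((∑ σ ∈ Finset.univ.filter (E m),
        (J.filter fun j => E (m + 1) ((Equiv.swap ⟨m, hmN⟩ j).trans σ)).card : ℕ) : ℝ) ≤
        (Finset.univ.filter (E m)).card * (θ m * (N - m)) := by
      push_cast
      refine (Finset.sum_le_card_nsmul _ _ _ fun σ hσ => ?_).trans (by rw [nsmul_eq_mul])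
      refine hbranch m hmN (by omega) σ (Finset.mem_filter.1 hσ).2 _ fun j hj => ?_
      have := Finset.mem_filter.1 hj
      exact ⟨by simpa [hJ] using this.1, this.2⟩
    rw [hdouble, Nat.cast_mul, hJcard] at hle
    linarith

/-- The probability that a random ordering takes prescribed values at `L.length` positions and
avoids, at its first `m` positions, a set of density at least `β` that is determined by the
first `m₀` positions. -/
theorem prob_pinned_avoid_le [DecidableEq α] {m₀ m : ℕ} (hN : Fintype.card α = N)
    (hm : 2 * m ≤ N)
    (B : (Fin N ≃ α) → Finset α) (G : (Fin N ≃ α) → Prop) {β : ℝ} (hβ : 0 ≤ β)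
    (hB : ∀ σ τ : Fin N ≃ α, (∀ i : Fin N, (i : ℕ) < m₀ → σ i = τ i) → B σ = B τ)
    (hG : ∀ σ τ : Fin N ≃ α, (∀ i : Fin N, (i : ℕ) < m₀ → σ i = τ i) → G σ → G τ)
    (hcard : ∀ σ, G σ → β * N ≤ (B σ).card)
    (L : List (ℕ × α)) (hL : (L.map Prod.fst).Nodup) (hLm : ∀ e ∈ L, e.1 < m) :
    prob (fun σ : Fin N ≃ α => G σ ∧ (∀ i : Fin N, (i : ℕ) < m → σ i ∉ B σ) ∧
      ∀ e ∈ L, ∀ i : Fin N, (i : ℕ) = e.1 → σ i = e.2) ≤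
      (2 / (N * Real.exp (-β))) ^ L.length * Real.exp (-β) ^ (m - m₀) := by
  classical
  set ρ := Real.exp (-β) with hρ
  have hρ0 : 0 < ρ := Real.exp_pos _
  have hρ1 : ρ ≤ 1 := Real.exp_le_one_iff.2 (by linarith)
  set P : Finset ℕ := (L.map Prod.fst).toFinset with hP
  have hPcard : P.card = L.length := by
    rw [hP, List.toFinset_card_of_nodup hL, List.length_map]
  have hPm : P ⊆ Finset.range m := by
    intro p hp
    obtain ⟨e, he, rfl⟩ := List.mem_map.1 (List.mem_toFinset.1 hp)
    exact Finset.mem_range.2 (hLm e he)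
  -- Avoidance is required only from `m₀` on, since `B σ` is not determined earlier; a pin is
  -- required only once its position is exposed.
  set E : ℕ → (Fin N ≃ α) → Prop := fun p σ =>
    (m₀ ≤ p → G σ ∧ ∀ i : Fin N, (i : ℕ) < p → σ i ∉ B σ) ∧
      ∀ e ∈ L, ∀ i : Fin N, (i : ℕ) = e.1 → (i : ℕ) < p → σ i = e.2 with hE
  -- A pinned position costs `2 / N` and gains nothing from avoidance. Dividing by `ρ` there lets
  -- every position from `m₀` on carry the factor `ρ`, so the product does not depend on where the
  -- pins lie.
  set θ : ℕ → ℝ := fun p => (if p ∈ P then 2 / (N * ρ) else 1) * (if m₀ ≤ p then ρ else 1)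
    with hθ
  have hprod : ∏ p ∈ Finset.range m, θ p = (2 / (N * ρ)) ^ L.length * ρ ^ (m - m₀) := by
    rw [hθ, Finset.prod_mul_distrib, Finset.prod_ite, Finset.prod_ite]
    simp only [Finset.prod_const, one_pow, mul_one]
    congr 2
    · rw [← hPcard]
      congr 1
      ext p
      simp only [Finset.mem_filter]
      exact ⟨fun h => h.2, fun h => ⟨hPm h, h⟩⟩
    · rw [← Nat.card_Ico]
      congr 1
      ext p
      simp only [Finset.mem_filter, Finset.mem_range, Finset.mem_Ico]
      omega
  rw [← hprod]
  refine le_trans (prob_mono ?_) (prob_le_prod E θ (by omega) ?_ ?_ ?_ ?_)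
  · rintro σ ⟨h1, h2, h3⟩
    exact ⟨fun _ => ⟨h1, h2⟩, fun e he i hi _ => h3 e he i hi⟩
  · intro p hp
    rw [hθ]; positivity
  · rintro p hp σ ⟨h1, h2⟩
    exact ⟨fun h => ⟨(h1 (by omega)).1, fun i hi => (h1 (by omega)).2 i (by omega)⟩,
      fun e he i hi hip => h2 e he i hi (by omega)⟩
  · rintro p hp σ τ hστ ⟨h1, h2⟩
    refine ⟨fun h => ?_, fun e he i hi hip => ?_⟩
    · have hag : ∀ i : Fin N, (i : ℕ) < m₀ → σ i = τ i := fun i hi => hστ i (by omega)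
      refine ⟨hG σ τ hag (h1 h).1, fun i hi => ?_⟩
      rw [← hB σ τ hag, ← hστ i hi]
      exact (h1 h).2 i hi
    · rw [← hστ i hip]; exact h2 e he i hi hip
  · intro p hp hpm σ hσ s hs
    have hN0 : (0 : ℝ) < N := by
      have : 0 < N := by omega
      exact_mod_cast this
    have hNp : (N : ℝ) ≤ 2 * (N - p) := by
      have : (2 * (p : ℕ) : ℝ) ≤ N := by exact_mod_cast (by omega : 2 * p ≤ N)
      linarith
    by_cases hpP : p ∈ P
    · obtain ⟨e, he, hep⟩ := List.mem_map.1 (List.mem_toFinset.1 hpP)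
      have hs1 : s ⊆ {σ.symm e.2} := by
        intro j hj
        have := (hs j hj).2.2 e he ⟨p, hp⟩ hep.symm (by simp)
        rw [Equiv.trans_apply, Equiv.swap_apply_left] at this
        rw [Finset.mem_singleton, ← this, Equiv.symm_apply_apply]
      have hs2 : (s.card : ℝ) ≤ 1 := by
        exact_mod_cast (Finset.card_le_card hs1).trans (by simp)
      refine hs2.trans ?_
      have hθp : 2 / N ≤ θ p := by
        rw [hθ]
        simp only [if_pos hpP]
        split_ifs
        · apply le_of_eq; field_simp
        · rw [mul_one]
          gcongr
          nlinarith
      calc (1 : ℝ) ≤ 2 / N * (N - p) := by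
            rw [div_mul_eq_mul_div, le_div_iff₀ hN0]; linarith
        _ ≤ θ p * (N - p) := by
            gcongr
            linarith
    · have hsJ : s ⊆ Finset.Ici (⟨p, hp⟩ : Fin N) := fun j hj => by
        simpa [Fin.le_def] using (hs j hj).1
      by_cases hpm₀ : m₀ ≤ p
      · have hθp : θ p = ρ := by rw [hθ]; simp [hpP, hpm₀]
        rw [hθp]
        obtain ⟨hGσ, hav⟩ := hσ.1 hpm₀
        -- The swap puts `σ j` at position `p`, so an admissible `j` has `σ j` outside `B σ`. Since
        -- `B σ` has not been hit yet, all of it lies among the remaining `N - p` positions, which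
        -- excludes at least `β * N` of them.
        have hdisj : Disjoint s ((B σ).map σ.symm.toEmbedding) := by
          rw [Finset.disjoint_left]
          intro j hj hjB
          have hj2 := (hs j hj)
          have h3 := (hj2.2.1 (by omega)).2 ⟨p, hp⟩ (by simp)
          rw [Equiv.trans_apply, Equiv.swap_apply_left] at h3
          rw [← hB σ] at h3
          · apply h3
            obtain ⟨a, ha, hab⟩ := Finset.mem_map.1 hjB
            rw [← hab]; simpa using ha
          · intro i hi
            rw [Equiv.trans_apply, Equiv.swap_apply_of_ne_of_ne]
            · exact fun h => by simp [h] at hi; omega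
            · exact fun h => by rw [h] at hi; omega
        have hsub : s ∪ (B σ).map σ.symm.toEmbedding ⊆ Finset.Ici (⟨p, hp⟩ : Fin N) := by
          refine Finset.union_subset hsJ fun j hj => ?_
          obtain ⟨a, ha, rfl⟩ := Finset.mem_map.1 hj
          rw [Finset.mem_Ici, Fin.le_def]
          by_contra hlt
          exact hav _ (not_le.1 hlt) (by simpa using ha)
        have hc := Finset.card_le_card hsub
        rw [Finset.card_union_of_disjoint hdisj, Finset.card_map, Fin.card_Ici] at hc
        have hc' : (s.card : ℝ) + (B σ).card ≤ N - p := by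
          have : s.card + (B σ).card + p ≤ N := by simp at hc; omega
          have : ((s.card + (B σ).card + p : ℕ) : ℝ) ≤ N := by exact_mod_cast this
          push_cast at this; linarith
        have hb := hcard σ hGσ
        have hexp : 1 - β ≤ ρ := by
          have := Real.add_one_le_exp (-β); linarith
        have hp0 : (0 : ℝ) ≤ p := by positivity
        calc (s.card : ℝ) ≤ (1 - β) * (N - p) := by nlinarith
          _ ≤ ρ * (N - p) := by
            gcongr
            linarith
      · have hθp : θ p = 1 := by rw [hθ]; simp [hpP, hpm₀]
        rw [hθp, one_mul]
        have hc := Finset.card_le_card hsJ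
        rw [Fin.card_Ici] at hc
        rw [← Nat.cast_sub hp.le]
        exact_mod_cast hc

end Orderings

/-! ### Most variables freeze early, and the cost of unfrozen sets -/

section FirstStage

variable {k n : ℕ}

/-- The set of variables that are not frozen. -/
noncomputable def unfrozen {n : ℕ} (F : Formula n) : Finset (Fin n) :=
  open Classical in Finset.univ.filter fun x => ¬ Frozen F x

theorem mem_unfrozen {F : Formula n} {x : Fin n} : x ∈ unfrozen F ↔ ¬ Frozen F x := by
  simp [unfrozen]

theorem unfrozen_anti {F G : Formula n} (h : F ⊆ G) : unfrozen G ⊆ unfrozen F := fun _ hx =>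
  mem_unfrozen.2 fun hF => mem_unfrozen.1 hx (hF.mono h)

/-- The clauses all of whose literals are TRUE under `φ` and on variables of `U`. -/
noncomputable def trueOn (k : ℕ) {n : ℕ} (φ : Assignment n) (U : Finset (Fin n)) :
    Finset (KClause k n) :=
  open Classical in Finset.univ.filter fun C => ∀ l ∈ C.1, l.1 ∈ U ∧ LitTrue φ l

/-- The clauses whose only TRUE literal under `φ` is also the only one on a variable of `U`. -/
noncomputable def supportedBy (k : ℕ) {n : ℕ} (φ : Assignment n) (U : Finset (Fin n)) :
    Finset (KClause k n) :=
  open Classical in Finset.univ.filter fun C => ∃ x ∈ U, (∃ l ∈ C.1, l.1 = x ∧ LitTrue φ l) ∧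
    ∀ l ∈ C.1, (l.1 = x ∧ LitTrue φ l) ∨ (l.1 ∉ U ∧ ¬ LitTrue φ l)

theorem choose_le_card_trueOn (φ : Assignment n) (U : Finset (Fin n)) :
    U.card.choose k ≤ (trueOn k φ U).card := by
  classical
  rw [← Finset.card_powersetCard]
  refine card_le_card_of_literalsOn _ _ φ (fun J hJ => (Finset.mem_powersetCard.1 hJ).2) ?_
  intro J hJ C hC
  refine Finset.mem_filter.2 ⟨Finset.mem_univ _, fun l hl => ?_⟩
  rw [hC, mem_literalsOn] at hl
  exact ⟨(Finset.mem_powersetCard.1 hJ).1 hl.1, hl.2.symm⟩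

/-- Take one variable of `U` and `k - 1` outside it, with signs true under `φ` on `U` and false
elsewhere. -/
theorem mul_choose_le_card_supportedBy (hk : 1 ≤ k) (φ : Assignment n) (U : Finset (Fin n)) :
    U.card * (Uᶜ.card).choose (k - 1) ≤ (supportedBy k φ U).card := by
  classical
  rw [← card_image_insert (disjoint_compl_right (a := U))]
  refine card_le_card_of_literalsOn _ _ (fun y => if y ∈ U then φ y else !φ y) ?_ ?_
  · intro J hJ
    obtain ⟨⟨x, I⟩, h, rfl⟩ := Finset.mem_image.1 hJ
    obtain ⟨hx, hI⟩ := Finset.mem_product.1 h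
    obtain ⟨hI, hc⟩ := Finset.mem_powersetCard.1 hI
    have : x ∉ I := fun hxI => Finset.mem_compl.1 (hI hxI) hx
    simp only at hc
    rw [Finset.card_insert_of_notMem this, hc]
    omega
  · intro J hJ C hC
    obtain ⟨⟨x, I⟩, h, rfl⟩ := Finset.mem_image.1 hJ
    obtain ⟨hx, hI⟩ := Finset.mem_product.1 h
    obtain ⟨hI, hc⟩ := Finset.mem_powersetCard.1 hI
    simp only at hx hI hC
    refine Finset.mem_filter.2 ⟨Finset.mem_univ _, x, hx, ⟨(x, φ x), ?_, rfl, rfl⟩, ?_⟩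
    · rw [hC, mem_literalsOn]
      exact ⟨Finset.mem_insert_self _ _, by simp [hx]⟩
    · intro l hl
      rw [hC, mem_literalsOn] at hl
      rcases Finset.mem_insert.1 hl.1 with h1 | h1
      · left
        refine ⟨h1, ?_⟩
        rw [LitTrue, hl.2, h1, if_pos hx]
      · right
        have h2 := Finset.mem_compl.1 (hI h1)
        refine ⟨h2, ?_⟩
        rw [LitTrue, hl.2, if_neg h2]
        simp

/-- If many variables are not frozen, then the scanned clauses avoid one of the sets
`trueOn k φ U` or `supportedBy k φ U` with `U` large. -/
theorem exists_avoided_of_le_card_unfrozen (hk : 1 ≤ k) (hn : 1 ≤ n) {m : ℕ}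
    {σ : ClauseOrder k n} (h : n ≤ 4 * (unfrozen (satProcess m σ)).card) :
    ∃ φ : Assignment n, ∃ U : Finset (Fin n), n ≤ 4 * U.card ∧
      ((∀ i : Fin (Fintype.card (KClause k n)), (i : ℕ) < m → σ i ∉ trueOn k φ U) ∨
        (2 * U.card ≤ n ∧ ∀ i : Fin (Fintype.card (KClause k n)), (i : ℕ) < m →
          σ i ∉ supportedBy k φ U)) := by
  classical
  set F := satProcess m σ with hF
  obtain ⟨φ, hφ⟩ := satisfiable_satProcess m σ
  by_contra! hcon
  have hcon := hcon φ
  set D : Assignment n → Finset (Fin n) := fun ψ => Finset.univ.filter fun x => φ x ≠ ψ x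
    with hD
  -- If `ψ` differs from `φ` on a large set, a scanned clause that is true under `φ` with all its
  -- variables in that set is included, but all its literals are false under `ψ`.
  have hsmall : ∀ ψ, Satisfies ψ F → 4 * (D ψ).card < n := by
    intro ψ hψ
    by_contra! hlt
    obtain ⟨i, hi, hiB⟩ := (hcon _ hlt).1
    have hB := (Finset.mem_filter.1 hiB).2
    have hmem : (σ i).1 ∈ F := by
      refine mem_satProcess hφ hi ?_
      have : (σ i).1.Nonempty := by
        rw [← Finset.card_pos, (σ i).2.1]; omega
      obtain ⟨l, hl⟩ := this
      exact ⟨l, hl, (hB l hl).2⟩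
    obtain ⟨l, hl, hlt⟩ := hψ _ hmem
    have h1 := (Finset.mem_filter.1 (hB l hl).1).2
    exact h1 ((hB l hl).2.trans hlt.symm)
  -- The satisfying assignments are added one at a time. Each difference set has fewer than `n / 4`
  -- elements, so a union that first reaches `n / 4` is still at most `n / 2`, and `supportedBy`
  -- applies. A scanned clause from that set is violated by any `ψ'` in `X` that flips its
  -- supporting variable, as `ψ'` agrees with `φ` outside the union.
  have hunion : ∀ X : Finset (Assignment n), (∀ ψ ∈ X, Satisfies ψ F) →
      4 * (X.biUnion D).card < n := by
    intro X
    induction X using Finset.induction_on with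
    | empty => intro _; simp; omega
    | insert ψ X hψX ih =>
      intro hX
      have ih := ih fun ψ hψ => hX ψ (Finset.mem_insert_of_mem hψ)
      have hψ := hsmall ψ (hX ψ (Finset.mem_insert_self _ _))
      set U := (insert ψ X).biUnion D with hU
      have hUcard : U.card ≤ (D ψ).card + (X.biUnion D).card := by
        rw [hU, Finset.biUnion_insert]
        exact Finset.card_union_le _ _
      by_contra! hlt
      obtain ⟨i, hi, hiB⟩ := (hcon _ hlt).2 (by omega)
      obtain ⟨x, hx, ⟨l, hl, -, hlφ⟩, hB⟩ := (Finset.mem_filter.1 hiB).2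
      have hmem : (σ i).1 ∈ F := mem_satProcess hφ hi ⟨l, hl, hlφ⟩
      obtain ⟨ψ', hψ', hxψ'⟩ := Finset.mem_biUnion.1 hx
      obtain ⟨l', hl', hl'ψ⟩ := hX ψ' hψ' _ hmem
      rcases hB l' hl' with ⟨h1, h2⟩ | ⟨h1, h2⟩
      · rw [← h1] at hxψ'
        exact (Finset.mem_filter.1 hxψ').2 (h2.trans hl'ψ.symm)
      · refine h1 (Finset.mem_biUnion.2 ⟨ψ', hψ', Finset.mem_filter.2 ⟨Finset.mem_univ _, ?_⟩⟩)
        intro h3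
        exact h2 (h3.trans hl'ψ)
  have hsub : unfrozen F ⊆ (Finset.univ.filter fun ψ => Satisfies ψ F).biUnion D := by
    intro x hx
    have hx := mem_unfrozen.1 hx
    unfold Frozen at hx
    push Not at hx
    obtain ⟨ψ, ψ', h1, h2, h3⟩ := hx
    by_cases h4 : φ x = ψ x
    · refine Finset.mem_biUnion.2 ⟨ψ', by simpa using h2,
        Finset.mem_filter.2 ⟨Finset.mem_univ _, ?_⟩⟩
      rwa [h4]
    · exact Finset.mem_biUnion.2 ⟨ψ, by simpa using h1, Finset.mem_filter.2 ⟨Finset.mem_univ _, h4⟩⟩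
  have h1 := hunion (Finset.univ.filter fun ψ => Satisfies ψ F) fun ψ hψ =>
    (Finset.mem_filter.1 hψ).2
  have h2 := Finset.card_le_card hsub
  omega

theorem prob_avoid_le {m : ℕ} (hm : 2 * m ≤ Fintype.card (KClause k n))
    (B : Finset (KClause k n)) {β : ℝ} (hβ : 0 ≤ β)
    (hB : β * Fintype.card (KClause k n) ≤ B.card) :
    prob (fun σ : ClauseOrder k n => ∀ i : Fin (Fintype.card (KClause k n)), (i : ℕ) < m →
      σ i ∉ B) ≤ Real.exp (-β) ^ m := by
  have := prob_pinned_avoid_le (α := KClause k n) (m₀ := 0) rfl hm (fun _ => B)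
    (fun _ => True) hβ (fun _ _ _ => rfl) (fun _ _ _ _ => trivial) (fun _ _ => hB) []
    (by simp) (by simp)
  simpa using this

/-- Union bound over `2 ^ n` assignments, `2 ^ n` sets and two kinds of avoided sets. The extra `1 /
4` in the exponent comes from `|U| ≥ n / 4` in the `supportedBy` case. -/
theorem prob_le_card_unfrozen_le (hk : 1 ≤ k) (hn : 8 * k ≤ n) {m : ℕ}
    (hm : 2 * m ≤ Fintype.card (KClause k n)) :
    prob (fun σ : ClauseOrder k n => n ≤ 4 * (unfrozen (satProcess m σ)).card) ≤
      2 * 4 ^ n * Real.exp (-((1 / 16) ^ k / 4)) ^ m := by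
  classical
  set N := Fintype.card (KClause k n) with hN
  have hη : (0 : ℝ) < (1 / 16) ^ k := by positivity
  set s : Finset (Assignment n × Finset (Fin n)) :=
    Finset.univ.filter fun q => n ≤ 4 * q.2.card with hs
  have hscard : (s.card : ℝ) ≤ 4 ^ n := by
    have : s.card ≤ 4 ^ n := by
      refine (Finset.card_le_univ _).trans (le_of_eq ?_)
      simp only [Fintype.card_prod, Fintype.card_fun, Fintype.card_bool, Fintype.card_fin,
        Fintype.card_finset]
      rw [← mul_pow]
      norm_num
    exact_mod_cast this
  refine le_trans (prob_mono (E' := fun σ => ∃ q ∈ s,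
    ((∀ i : Fin (Fintype.card (KClause k n)), (i : ℕ) < m → σ i ∉ trueOn k q.1 q.2) ∨
        (2 * q.2.card ≤ n ∧ ∀ i : Fin (Fintype.card (KClause k n)), (i : ℕ) < m →
          σ i ∉ supportedBy k q.1 q.2))) ?_) ?_
  · intro σ hσ
    obtain ⟨φ, U, hU, h⟩ := exists_avoided_of_le_card_unfrozen hk (by omega) hσ
    exact ⟨(φ, U), by simpa [hs] using hU, h⟩
  refine (prob_exists_le_card_mul s _ (b := 2 * Real.exp (-((1 / 16) ^ k / 4)) ^ m) ?_).trans ?_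
  · rintro ⟨φ, U⟩ hq
    have hU : n ≤ 4 * U.card := by simpa [hs] using hq
    refine (prob_or_le _ _).trans ?_
    rw [two_mul (Real.exp _ ^ m)]
    refine add_le_add ?_ ?_
    · refine prob_avoid_le hm _ (by positivity) ?_
      have h1 := card_kClause_le_choose (k := k) hn hU
      have h2 : ((U.card.choose k : ℕ) : ℝ) ≤ (trueOn k φ U).card := by
        exact_mod_cast choose_le_card_trueOn φ U
      have h3 : (0 : ℝ) ≤ (1 / 16) ^ k * (N : ℝ) := by positivity
      rw [← hN] at h1 ⊢
      linarith
    · by_cases hU2 : 2 * U.card ≤ n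
      · refine (prob_mono fun σ h => h.2).trans (prob_avoid_le hm _ (by positivity) ?_)
        have hc : Uᶜ.card = n - U.card := by simp [Finset.card_compl]
        have h1 := card_kClause_le_mul_choose (k := k) (a := Uᶜ.card) hk hn (by omega)
        have h2 : ((U.card * Uᶜ.card.choose (k - 1) : ℕ) : ℝ) ≤ (supportedBy k φ U).card := by
          exact_mod_cast mul_choose_le_card_supportedBy hk φ U
        push_cast at h2
        have h3 : (n : ℝ) ≤ 4 * U.card := by exact_mod_cast hU
        have h4 : (0 : ℝ) ≤ (Uᶜ.card.choose (k - 1) : ℕ) := by positivity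
        rw [← hN] at h1 ⊢
        nlinarith
      · have : prob (fun σ : ClauseOrder k n => 2 * U.card ≤ n ∧
            ∀ i : Fin (Fintype.card (KClause k n)), (i : ℕ) < m → σ i ∉ supportedBy k φ U) = 0 := by
          simp [prob, hU2]
        simp only
        rw [this]; positivity
  · calc (s.card : ℝ) * (2 * Real.exp (-((1 / 16) ^ k / 4)) ^ m)
        ≤ 4 ^ n * (2 * Real.exp (-((1 / 16) ^ k / 4)) ^ m) := by gcongr
      _ = _ := by ring

/-- One variable of `S` combined with `k - 1` frozen variables, all signed against a satisfying
assignment `φ`: the frozen literals are then false under every satisfying assignment. -/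
theorem mul_choose_le_card_forcing (hk : 1 ≤ k) {F : Formula n} (hF : Satisfiable F)
    {S : Finset (Fin n)} (hS : S ⊆ unfrozen F) [DecidableEq (KClause k n)] :
    S.card * ((unfrozen F)ᶜ.card).choose (k - 1) ≤ (S.biUnion (forcing k F)).card := by
  classical
  obtain ⟨φ, hφ⟩ := hF
  have hdisj : Disjoint S (unfrozen F)ᶜ := by
    rw [Finset.disjoint_left]
    exact fun x hx hx' => Finset.mem_compl.1 hx' (hS hx)
  rw [← card_image_insert hdisj]
  refine card_le_card_of_literalsOn _ _ (fun y => !φ y) ?_ ?_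
  · intro J hJ
    obtain ⟨⟨x, I⟩, h, rfl⟩ := Finset.mem_image.1 hJ
    obtain ⟨hx, hI⟩ := Finset.mem_product.1 h
    obtain ⟨hI, hc⟩ := Finset.mem_powersetCard.1 hI
    have : x ∉ I := fun hxI => Finset.mem_compl.1 (hI hxI) (hS hx)
    simp only at hc
    rw [Finset.card_insert_of_notMem this, hc]
    omega
  · intro J hJ C hC
    obtain ⟨⟨x, I⟩, h, rfl⟩ := Finset.mem_image.1 hJ
    obtain ⟨hx, hI⟩ := Finset.mem_product.1 h
    obtain ⟨hI, hc⟩ := Finset.mem_powersetCard.1 hI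
    simp only at hx hI hC
    refine Finset.mem_biUnion.2 ⟨x, hx, Finset.mem_filter.2 ⟨Finset.mem_univ _, ?_, ?_⟩⟩
    · exact ⟨(x, !φ x), by rw [hC, mem_literalsOn]; simp, rfl⟩
    · intro l hl hlx ψ hψ
      rw [hC, mem_literalsOn] at hl
      have hfr : Frozen F l.1 := by
        have := Finset.mem_compl.1 (hI ((Finset.mem_insert.1 hl.1).resolve_left hlx))
        rw [mem_unfrozen] at this
        exact not_not.1 this
      rw [LitTrue, hl.2, hfr ψ φ hψ hφ]
      simp

/-- The probability that the variables of `S` are not frozen after `m` steps, that few variables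
are not frozen after `m₀` steps, and that the clauses at the positions in `L` are prescribed. -/
theorem prob_pinned_unfrozen_le (hk : 1 ≤ k) (hn : 8 * k ≤ n) {m₀ m : ℕ} (hm₀ : m₀ ≤ m)
    (hm : 2 * m ≤ Fintype.card (KClause k n)) (S : Finset (Fin n))
    (L : List (ℕ × KClause k n)) (hL : (L.map Prod.fst).Nodup) (hLm : ∀ e ∈ L, e.1 < m) :
    prob (fun σ : ClauseOrder k n => 4 * (unfrozen (satProcess m₀ σ)).card < n ∧
      S ⊆ unfrozen (satProcess m σ) ∧
      ∀ e ∈ L, ∀ i : Fin (Fintype.card (KClause k n)), (i : ℕ) = e.1 → σ i = e.2) ≤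
    (2 / (Fintype.card (KClause k n) * Real.exp (-((1 / 16) ^ k * (S.card / n))))) ^ L.length *
      Real.exp (-((1 / 16) ^ k * (S.card / n))) ^ (m - m₀) := by
  classical
  refine le_trans (prob_mono ?_) (prob_pinned_avoid_le (α := KClause k n) (m₀ := m₀) rfl hm
    (fun σ => S.biUnion (forcing k (satProcess m₀ σ)))
    (fun σ => 4 * (unfrozen (satProcess m₀ σ)).card < n ∧ S ⊆ unfrozen (satProcess m₀ σ))
    (by positivity) ?_ ?_ ?_ L hL hLm)
  · rintro σ ⟨h1, h2, h3⟩
    refine ⟨⟨h1, h2.trans (unfrozen_anti (satProcess_mono hm₀ σ))⟩, ?_, h3⟩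
    intro i hi hiB
    obtain ⟨x, hx, hxi⟩ := Finset.mem_biUnion.1 hiB
    exact mem_unfrozen.1 (h2 hx) (frozen_of_forcing hm₀ hi hxi)
  · intro σ τ h
    rw [satProcess_congr h]
  · intro σ τ h
    rw [satProcess_congr h]; exact id
  · rintro σ ⟨h1, h2⟩
    have h3 := mul_choose_le_card_forcing hk (satisfiable_satProcess m₀ σ) h2
    have hc : (unfrozen (satProcess m₀ σ))ᶜ.card = n - (unfrozen (satProcess m₀ σ)).card := by
      simp [Finset.card_compl]
    have h4 := card_kClause_le_mul_choose (k := k) (a := (unfrozen (satProcess m₀ σ))ᶜ.card)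
      hk hn (by omega)
    have hn0 : (0 : ℝ) < n := by
      have : 0 < n := by omega
      exact_mod_cast this
    have h3' : ((S.card * (unfrozen (satProcess m₀ σ))ᶜ.card.choose (k - 1) : ℕ) : ℝ) ≤
      (S.biUnion (forcing k (satProcess m₀ σ))).card := by exact_mod_cast h3
    push_cast at h3'
    refine le_trans ?_ h3'
    calc (1 / 16 : ℝ) ^ k * (S.card / n) * Fintype.card (KClause k n)
        = S.card * (((1 / 16 : ℝ) ^ k * Fintype.card (KClause k n)) / n) := by ring
      _ ≤ S.card * ((unfrozen (satProcess m₀ σ))ᶜ.card.choose (k - 1) : ℕ) := by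
        gcongr
        rw [div_le_iff₀ hn0]
        linarith

end FirstStage

/-! ### Explorations of components -/

section Exploration

variable {k n : ℕ}

open Classical in
/-- The records of queue-based explorations that add `r` clauses within the given number of
moves: a move either removes the head of the queue, or records a position `< m`, a clause through
the head of the queue and a variable of the clause, and appends the variables of the clause to the
queue. -/
noncomputable def explorations (k : ℕ) {n : ℕ} (m : ℕ) :
    ℕ → List (Fin n) → ℕ → Finset (List ((ℕ × KClause k n) × Fin n))
  | _, _, 0 => {[]}
  | 0, _, _ + 1 => ∅
  | _ + 1, [], _ + 1 => ∅
  | f + 1, q :: Q, r + 1 => explorations k m f Q (r + 1) ∪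
      (Finset.range m ×ˢ clausesAt k q).biUnion fun e => (e.2.1.image Prod.fst).biUnion fun x =>
        (explorations k m f (q :: Q ++ (e.2.1.image Prod.fst).toList) r).image
          (List.cons (e, x))

/-- Each of the `f` moves either discards the head or records one of at most `M` triples of
position, clause and variable, whence `2 ^ f` for the pattern and `M ^ r` for the records. -/
theorem card_explorations_le {m : ℕ} {M : ℝ} (hM : 1 ≤ M)
    (h : ∀ u : Fin n, (m * (clausesAt k u).card * k : ℝ) ≤ M) (f : ℕ) (Q : List (Fin n))
    (r : ℕ) : ((explorations k m f Q r).card : ℝ) ≤ 2 ^ f * M ^ r := by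
  classical
  induction f generalizing Q r with
  | zero =>
    cases r with
    | zero => simp [explorations]
    | succ r => simp [explorations]; positivity
  | succ f ih =>
    cases r with
    | zero => simp [explorations]; exact one_le_pow₀ (by norm_num)
    | succ r =>
      cases Q with
      | nil => simp [explorations]; positivity
      | cons q Q =>
        rw [explorations]
        have h1 : ∀ e ∈ Finset.range m ×ˢ clausesAt k q,
            ((((e.2.1.image Prod.fst).biUnion fun x =>
              (explorations k m f (q :: Q ++ (e.2.1.image Prod.fst).toList) r).image
                (List.cons (e, x))).card : ℕ) : ℝ) ≤ k * (2 ^ f * M ^ r) := by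
          intro e _
          refine (Nat.cast_le.2 (Finset.card_biUnion_le.trans
            (Finset.sum_le_sum fun x _ => Finset.card_image_le))).trans ?_
          rw [Finset.sum_const, e.2.2.2, smul_eq_mul, Nat.cast_mul]
          gcongr
          exact ih _ _
        refine (Nat.cast_le.2 (Finset.card_union_le _ _)).trans ?_
        rw [Nat.cast_add]
        have h2 := ih Q (r + 1)
        have h3 : ((((Finset.range m ×ˢ clausesAt k q).biUnion fun e =>
            (e.2.1.image Prod.fst).biUnion fun x =>
              (explorations k m f (q :: Q ++ (e.2.1.image Prod.fst).toList) r).image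
                (List.cons (e, x))).card : ℕ) : ℝ) ≤ M * (2 ^ f * M ^ r) := by
          refine (Nat.cast_le.2 Finset.card_biUnion_le).trans ?_
          rw [Nat.cast_sum]
          refine (Finset.sum_le_card_nsmul _ _ _ h1).trans ?_
          rw [Finset.card_product, Finset.card_range, nsmul_eq_mul, Nat.cast_mul, ← mul_assoc]
          gcongr
          exact h q
        calc _ ≤ 2 ^ f * M ^ (r + 1) + M * (2 ^ f * M ^ r) := add_le_add h2 h3
          _ = _ := by ring

/-- A set `K` that is connected by the present clauses and has enough elements outside of the
visited set `V` admits an exploration. -/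
theorem exists_mem_explorations {m : ℕ} (Pr : ℕ → KClause k n → Prop) (Z : Fin n → Prop)
    (K : Set (Fin n))
    (hfun : ∀ p C C', Pr p C → Pr p C' → C = C')
    (hconn : ∀ V : Finset (Fin n), (∃ v ∈ K, v ∈ V) → (∃ v ∈ K, v ∉ V) →
      ∃ p C, p < m ∧ Pr p C ∧ (∃ q ∈ K, q ∈ V ∧ q ∈ C.1.image Prod.fst) ∧
        ∃ x ∈ K, x ∉ V ∧ x ∈ C.1.image Prod.fst ∧ Z x)
    (f : ℕ) (Q : List (Fin n)) (r : ℕ) (V : Finset (Fin n))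
    (hKV : ∃ v ∈ K, v ∈ V)
    (hsat : ∀ v ∈ K, v ∈ V → v ∉ Q → ∀ p C, p < m → Pr p C → v ∈ C.1.image Prod.fst →
      ∀ x ∈ K, x ∈ C.1.image Prod.fst → Z x → x ∈ V)
    (hcard : V.card + k * r < K.ncard + k) (hf : Q.length + (k + 1) * r ≤ f) :
    ∃ R ∈ explorations k m f Q r, R.length = r ∧
      (∀ e ∈ R, e.1.1 < m ∧ Pr e.1.1 e.1.2 ∧ e.2 ∉ V ∧ Z e.2 ∧ e.2 ∈ e.1.2.1.image Prod.fst) ∧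
      (R.map fun e => e.1.1).Nodup ∧ (R.map Prod.snd).Nodup := by
  classical
  -- The invariant `hsat` says that a visited element of `K` that has left the queue has no
  -- unvisited neighbour left. A recorded clause visits at most `k` new variables, which `hcard`
  -- pays for, and uses one move plus `k` queue entries, which `hf` pays for.
  induction f generalizing Q r V with
  | zero =>
    have hr : r = 0 := by
      by_contra hr
      have : 0 < (k + 1) * r := Nat.mul_pos (by omega) (by omega)
      omega
    subst hr
    exact ⟨[], by simp [explorations], by simp⟩
  | succ f ih =>
    cases r with
    | zero => exact ⟨[], by simp [explorations], by simp⟩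
    | succ r =>
      have hnot : ∃ v ∈ K, v ∉ V := by
        by_contra! hall
        have h1 : K.ncard ≤ V.card := by
          rw [← Set.ncard_coe_finset]
          exact Set.ncard_le_ncard hall (Finset.finite_toSet V)
        rw [Nat.mul_succ] at hcard
        omega
      by_cases hhead : ∃ q Q', Q = q :: Q' ∧ q ∈ K ∧ q ∈ V ∧ ∃ p C, p < m ∧ Pr p C ∧
          q ∈ C.1.image Prod.fst ∧ ∃ x ∈ K, x ∈ C.1.image Prod.fst ∧ Z x ∧ x ∉ V
      · obtain ⟨q, Q', rfl, hqK, hqV, p, C, hp, hPr, hqC, x, hxK, hxC, hZx, hxV⟩ := hhead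
        obtain ⟨R, hR, hlen, hall, hnd1, hnd2⟩ := ih (q :: Q' ++ (C.1.image Prod.fst).toList) r
          (V ∪ C.1.image Prod.fst) ⟨q, hqK, Finset.mem_union_left _ hqV⟩ (by
            intro v hvK hv hvQ p' C' hp' hPr' hvC' x' hx'K hx'C' hZ'
            rw [List.mem_append, not_or, Finset.mem_toList] at hvQ
            refine Finset.mem_union_left _ ?_
            exact hsat v hvK ((Finset.mem_union.1 hv).resolve_right hvQ.2) hvQ.1 p' C' hp' hPr'
              hvC' x' hx'K hx'C' hZ') (by
            have h1 := Finset.card_union_le V (C.1.image Prod.fst)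
            rw [C.2.2] at h1
            rw [Nat.mul_succ] at hcard
            omega) (by
            rw [List.length_append, Finset.length_toList, C.2.2]
            rw [Nat.mul_succ] at hf
            omega)
        refine ⟨((p, C), x) :: R, ?_, by simp [hlen], ?_, ?_, ?_⟩
        · rw [explorations]
          refine Finset.mem_union_right _ (Finset.mem_biUnion.2 ⟨(p, C), ?_,
            Finset.mem_biUnion.2 ⟨x, hxC, Finset.mem_image.2 ⟨R, hR, rfl⟩⟩⟩)
          exact Finset.mem_product.2 ⟨Finset.mem_range.2 hp,
            Finset.mem_filter.2 ⟨Finset.mem_univ _, hqC⟩⟩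
        · intro e he
          rcases List.mem_cons.1 he with rfl | he
          · exact ⟨hp, hPr, hxV, hZx, hxC⟩
          · obtain ⟨h1, h2, h3, h4, h5⟩ := hall e he
            exact ⟨h1, h2, fun h => h3 (Finset.mem_union_left _ h), h4, h5⟩
        · rw [List.map_cons, List.nodup_cons]
          refine ⟨fun hmem => ?_, hnd1⟩
          -- A repeated position would repeat the clause `C`, but all variables of `C` are visited
          -- by then, so it could not find a new one.
          obtain ⟨e, he, hep⟩ := List.mem_map.1 hmem
          obtain ⟨h1, h2, h3, h4, h5⟩ := hall e he
          rw [hep] at h2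
          rw [hfun _ _ _ h2 hPr] at h5
          exact h3 (Finset.mem_union_right _ h5)
        · rw [List.map_cons, List.nodup_cons]
          refine ⟨fun hmem => ?_, hnd2⟩
          obtain ⟨e, he, hep⟩ := List.mem_map.1 hmem
          obtain ⟨h1, h2, h3, h4, h5⟩ := hall e he
          simp only at hep
          rw [hep] at h3
          exact h3 (Finset.mem_union_right _ hxC)
      · cases Q with
        | nil =>
          obtain ⟨p, C, hp, hPr, ⟨q, hqK, hqV, hqC⟩, x, hxK, hxV, hxC, hZ⟩ := hconn V hKV hnot
          exact absurd (hsat q hqK hqV (by simp) p C hp hPr hqC x hxK hxC hZ) hxV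
        | cons q Q =>
          obtain ⟨R, hR, hrest⟩ := ih Q (r + 1) V hKV (by
            intro v hvK hvV hvQ p C hp hPr hvC x hxK hxC hZ
            by_cases hvq : v = q
            · subst hvq
              by_contra hxV
              exact hhead ⟨v, Q, rfl, hvK, hvV, p, C, hp, hPr, hvC, x, hxK, hxC, hZ, hxV⟩
            · exact hsat v hvK hvV (by simp [hvq, hvQ]) p C hp hPr hvC x hxK hxC hZ) hcard
            (by simp only [List.length_cons] at hf; omega)
          refine ⟨R, ?_, hrest⟩
          rw [explorations]
          exact Finset.mem_union_left _ hR

/-- A vertex of a residual clause is a variable that has not been assigned. -/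
theorem of_mem_residual {F : Formula n} {A : Set (Fin n)} {φ : Assignment n}
    {C : Finset (Literal n)} (hC : C ∈ residual F A φ) :
    ∃ D ∈ F, C ⊆ D ∧ ∀ l ∈ C, l.1 ∉ A := by
  classical
  obtain ⟨D, hD, rfl⟩ := Finset.mem_image.1 hC
  obtain ⟨hDF, hD⟩ := Finset.mem_filter.1 hD
  refine ⟨D, hDF, Finset.filter_subset _ _, fun l hl hlA => ?_⟩
  obtain ⟨hlD, hl⟩ := Finset.mem_filter.1 hl
  exact hD ⟨l, hlD, hlA, by_contra fun h => hl ⟨hlA, h⟩⟩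

/-- A large component of the formula induced by the variables that are not frozen yields an
exploration along scanned clauses. -/
theorem exists_exploration_of_component {m : ℕ} {σ : ClauseOrder k n} {φ : Assignment n}
    (K : (formulaGraph (residual (satProcess m σ) {x | Frozen (satProcess m σ) x}
      φ)).ConnectedComponent) {r : ℕ} (hr : 1 + k * r < K.supp.ncard + k) :
    ∃ x₀ : Fin n, ∃ R ∈ explorations k m (1 + (k + 1) * r) [x₀] r, R.length = r ∧
      (∀ e ∈ R, e.1.1 < m ∧ e.2 ∈ unfrozen (satProcess m σ) ∧
        ∀ i : Fin (Fintype.card (KClause k n)), (i : ℕ) = e.1.1 → σ i = e.1.2) ∧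
      (R.map fun e => e.1.1).Nodup ∧ (R.map Prod.snd).Nodup := by
  classical
  obtain ⟨x₀, hx₀⟩ := K.nonempty_supp
  refine ⟨x₀, ?_⟩
  have hex := exists_mem_explorations (m := m)
    (fun p C => ∃ i : Fin (Fintype.card (KClause k n)), (i : ℕ) = p ∧ σ i = C)
    (fun x => ¬ Frozen (satProcess m σ) x) K.supp ?_ ?_ (1 + (k + 1) * r) [x₀] r {x₀}
    ⟨x₀, hx₀, by simp⟩ ?_ (by rw [Finset.card_singleton]; exact hr) (by simp)
  · obtain ⟨R, hR, hlen, hall, hnd⟩ := hex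
    refine ⟨R, hR, hlen, fun e he => ?_, hnd⟩
    obtain ⟨h1, ⟨i, hi, hiC⟩, -, h4, -⟩ := hall e he
    refine ⟨h1, mem_unfrozen.2 h4, fun j hj => ?_⟩
    rw [← hiC]
    congr 1
    exact Fin.ext (hj.trans hi.symm)
  · rintro p C C' ⟨i, hi, rfl⟩ ⟨j, hj, rfl⟩
    congr 1
    exact Fin.ext (hi.trans hj.symm)
  · rintro V ⟨u, huK, huV⟩ ⟨v, hvK, hvV⟩
    have huv : SimpleGraph.Reachable _ u v :=
      SimpleGraph.ConnectedComponent.exact (huK.trans hvK.symm)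
    obtain ⟨w⟩ := huv
    -- A walk from `u` to `v` leaves the visited set along some edge, and this edge comes from an
    -- included clause.
    obtain ⟨d, hd, hd1, hd2⟩ := w.exists_boundary_dart (V : Set (Fin n)) huV hvV
    have hfst : d.fst ∈ K.supp := by
      have hmem := w.dart_fst_mem_support_of_mem_darts hd
      have h1 : SimpleGraph.Reachable _ u d.fst := ⟨w.takeUntil _ hmem⟩
      exact (SimpleGraph.ConnectedComponent.sound h1).symm.trans huK
    have hsnd : d.snd ∈ K.supp :=
      (SimpleGraph.ConnectedComponent.sound d.adj.reachable).symm.trans hfst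
    obtain ⟨-, C, hC, ⟨l, hl, hl1⟩, ⟨l', hl', hl'1⟩⟩ := d.adj
    obtain ⟨D, hDF, hCD, hDA⟩ := of_mem_residual hC
    obtain ⟨i, hi, hiD⟩ := exists_of_mem_satProcess hDF
    refine ⟨i, σ i, hi, ⟨i, rfl, rfl⟩, ⟨d.fst, hfst, hd1, ?_⟩, d.snd, hsnd, hd2, ?_, ?_⟩
    · rw [hiD, ← hl1]; exact Finset.mem_image_of_mem _ (hCD hl)
    · rw [hiD, ← hl'1]; exact Finset.mem_image_of_mem _ (hCD hl')
    · rw [← hl'1]; exact hDA l' hl'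
  · intro v _ hv hvQ
    exact absurd (Finset.mem_singleton.1 hv) (by simpa using hvQ)

end Exploration

/-! ### Union bounds and numerical estimates -/

section Bounds

variable {k n : ℕ}

theorem prob_le_card_unfrozen_le_choose (hk : 1 ≤ k) (hn : 8 * k ≤ n) {m₀ m : ℕ} (hm₀ : m₀ ≤ m)
    (hm : 2 * m ≤ Fintype.card (KClause k n)) (b : ℕ) :
    prob (fun σ : ClauseOrder k n => 4 * (unfrozen (satProcess m₀ σ)).card < n ∧
      b ≤ (unfrozen (satProcess m σ)).card) ≤
      n.choose b * Real.exp (-((1 / 16) ^ k * (b / n))) ^ (m - m₀) := by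
  refine le_trans (prob_mono (E' := fun σ : ClauseOrder k n =>
    ∃ S ∈ (Finset.univ : Finset (Fin n)).powersetCard b,
      4 * (unfrozen (satProcess m₀ σ)).card < n ∧ S ⊆ unfrozen (satProcess m σ) ∧
      ∀ e ∈ ([] : List (ℕ × KClause k n)), ∀ i : Fin (Fintype.card (KClause k n)),
        (i : ℕ) = e.1 → σ i = e.2) ?_)
    ((prob_exists_le_card_mul _ _ (b := Real.exp (-((1 / 16) ^ k * (b / n))) ^ (m - m₀))
      ?_).trans ?_)
  · rintro σ ⟨h1, h2⟩
    obtain ⟨S, hS, hSc⟩ := Finset.exists_subset_card_eq h2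
    exact ⟨S, Finset.mem_powersetCard.2 ⟨Finset.subset_univ _, hSc⟩, h1, hS, by simp⟩
  · intro S hS
    have := prob_pinned_unfrozen_le hk hn hm₀ hm S [] (by simp) (by simp)
    rw [(Finset.mem_powersetCard.1 hS).2, List.length_nil, pow_zero, one_mul] at this
    exact this
  · rw [Finset.card_powersetCard, Finset.card_univ, Fintype.card_fin]

theorem prob_exists_component_le (hk : 1 ≤ k) (hn : 8 * k ≤ n) {m₀ m : ℕ} (hm₀ : m₀ ≤ m)
    (hm : 2 * m ≤ Fintype.card (KClause k n)) (r : ℕ) {M : ℝ} (hM : 1 ≤ M)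
    (h : ∀ u : Fin n, (m * (clausesAt k u).card * k : ℝ) ≤ M) :
    prob (fun σ : ClauseOrder k n => 4 * (unfrozen (satProcess m₀ σ)).card < n ∧
      ∃ φ, ∃ K : (formulaGraph (residual (satProcess m σ) {x | Frozen (satProcess m σ) x}
        φ)).ConnectedComponent, 1 + k * r < K.supp.ncard + k) ≤
      n * (2 ^ (1 + (k + 1) * r) * M ^ r *
        ((2 / (Fintype.card (KClause k n) * Real.exp (-((1 / 16) ^ k * (r / n))))) ^ r *
          Real.exp (-((1 / 16) ^ k * (r / n))) ^ (m - m₀))) := by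
  classical
  set N := Fintype.card (KClause k n) with hN
  set ρ := Real.exp (-((1 / 16 : ℝ) ^ k * (r / n))) with hρ
  -- Distinct positions make the pins admissible, and distinct variables make the unfrozen set have
  -- exactly `r` elements.
  set good : List ((ℕ × KClause k n) × Fin n) → Prop := fun R => R.length = r ∧
    (∀ e ∈ R, e.1.1 < m) ∧ (R.map fun e => e.1.1).Nodup ∧ (R.map Prod.snd).Nodup
  refine le_trans (prob_mono (E' := fun σ : ClauseOrder k n =>
    ∃ x₀ ∈ (Finset.univ : Finset (Fin n)),
      ∃ R ∈ (explorations k m (1 + (k + 1) * r) [x₀] r).filter good,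
        4 * (unfrozen (satProcess m₀ σ)).card < n ∧
        (R.map Prod.snd).toFinset ⊆ unfrozen (satProcess m σ) ∧
        ∀ e ∈ R.map Prod.fst, ∀ i : Fin N, (i : ℕ) = e.1 → σ i = e.2) ?_)
    ((prob_exists_le_card_mul _ _
      (b := 2 ^ (1 + (k + 1) * r) * M ^ r * ((2 / (N * ρ)) ^ r * ρ ^ (m - m₀))) ?_).trans ?_)
  · rintro σ ⟨h1, φ, K, hK⟩
    obtain ⟨x₀, R, hR, hlen, hall, hnd1, hnd2⟩ := exists_exploration_of_component K hK
    refine ⟨x₀, Finset.mem_univ _, R, Finset.mem_filter.2 ⟨hR, hlen, fun e he => (hall e he).1,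
      hnd1, hnd2⟩, h1, ?_, ?_⟩
    · intro x hx
      obtain ⟨e, he, rfl⟩ := List.mem_map.1 (List.mem_toFinset.1 hx)
      exact (hall e he).2.1
    · intro e' he' i hi
      obtain ⟨e, he, rfl⟩ := List.mem_map.1 he'
      exact (hall e he).2.2 i hi
  · intro x₀ _
    refine (prob_exists_le_card_mul _ _ (b := (2 / (N * ρ)) ^ r * ρ ^ (m - m₀)) ?_).trans ?_
    · intro R hR
      obtain ⟨hlen, hpos, hnd1, hnd2⟩ := (Finset.mem_filter.1 hR).2
      have := prob_pinned_unfrozen_le hk hn hm₀ hm (R.map Prod.snd).toFinset (R.map Prod.fst)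
        (by rw [List.map_map]; exact hnd1) (by
          intro e' he'
          obtain ⟨e, he, rfl⟩ := List.mem_map.1 he'
          exact hpos e he)
      rw [List.toFinset_card_of_nodup hnd2, List.length_map, List.length_map, hlen] at this
      exact this
    · have hρ0 : 0 < ρ := Real.exp_pos _
      gcongr
      refine le_trans ?_ (card_explorations_le hM h (1 + (k + 1) * r) [x₀] r)
      exact_mod_cast Finset.card_filter_le _ _
  · rw [Finset.card_univ, Fintype.card_fin]

/-- The binomial union bound for the number of variables that are not frozen. -/
theorem choose_mul_exp_le_one_div {n : ℕ} {a t : ℝ} (hn : 0 < n) (ht : 1 ≤ a * t) {b : ℕ}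
    (hb : Real.exp (-(a * t)) * n < b) {D : ℝ} (hD : 6 * (a * t) * n ≤ 8 * a * D) :
    n.choose b * Real.exp (-(8 * a * (b / n) * D)) ≤ 1 / n := by
  have hn0 : (0 : ℝ) < n := by exact_mod_cast hn
  have hb0 : (0 : ℝ) < b := lt_of_le_of_lt (by positivity) hb
  have hb1 : (1 : ℝ) ≤ b := by
    have : 0 < b := by exact_mod_cast hb0
    exact_mod_cast this
  -- Since `exp (-(a * t)) * n < b`, a single term of the exponential series bounds `(exp (-(a * t))
  -- * n) ^ b / b!` by `exp b`.
  have h1 : (n.choose b : ℝ) ≤ Real.exp (b * (a * t) + b) := by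
    refine (Nat.choose_le_pow_div b n).trans ?_
    have h2 := Real.pow_div_factorial_le_exp (Real.exp (-(a * t)) * n) (by positivity) b
    calc (n : ℝ) ^ b / b.factorial
        = Real.exp (b * (a * t)) * ((Real.exp (-(a * t)) * n) ^ b / b.factorial) := by
          rw [mul_pow, ← Real.exp_nat_mul, mul_div_assoc, ← mul_assoc, ← Real.exp_add]
          simp
      _ ≤ Real.exp (b * (a * t)) * Real.exp b := by
          gcongr
          exact h2.trans (Real.exp_le_exp.2 hb.le)
      _ = _ := by rw [Real.exp_add]
  have h3 : Real.log n ≤ a * t + b := by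
    have h4 := Real.log_le_log (by positivity) hb.le
    rw [Real.log_mul (Real.exp_pos _).ne' hn0.ne', Real.log_exp] at h4
    have h5 := Real.log_le_sub_one_of_pos hb0
    linarith
  calc n.choose b * Real.exp (-(8 * a * (b / n) * D))
      ≤ Real.exp (b * (a * t) + b) * Real.exp (-(6 * (a * t) * b)) := by
        refine mul_le_mul h1 (Real.exp_le_exp.2 (neg_le_neg ?_)) (Real.exp_pos _).le
          (Real.exp_pos _).le
        calc 6 * (a * t) * b = (6 * (a * t) * n) * (b / n) := by field_simp
          _ ≤ (8 * a * D) * (b / n) := by gcongr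
          _ = _ := by ring
    _ = Real.exp (b - 5 * (a * t) * b) := by rw [← Real.exp_add]; congr 1; ring
    _ ≤ Real.exp (-Real.log n) := by
        apply Real.exp_le_exp.2
        nlinarith
    _ = 1 / n := by rw [Real.exp_neg, Real.exp_log hn0, one_div]

/-- Both `Λ / a` and `a * t` are below their exponentials; the remaining `exp (-(3 * a * t))`
absorbs `exp (Λ / a)` and leaves `exp (-s)`. -/
theorem mul_mul_exp_le {Λ a t s : ℝ} (ha : 0 < a) (hΛ : 0 ≤ Λ)
    (ht : s + Λ / a ≤ a * t) (hs : 0 ≤ s) :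
    Λ * t * Real.exp (-(4 * (a * t))) ≤ Real.exp (-s) := by
  have hat : 0 ≤ a * t := le_trans (by positivity) ht
  have h1 : a * t ≤ Real.exp (a * t) := by linarith [Real.add_one_le_exp (a * t)]
  have h2 : Λ / a ≤ Real.exp (Λ / a) := by linarith [Real.add_one_le_exp (Λ / a)]
  calc Λ * t * Real.exp (-(4 * (a * t)))
      = (Λ / a) * (a * t) * Real.exp (-(4 * (a * t))) := by field_simp
    _ ≤ Real.exp (Λ / a) * Real.exp (a * t) * Real.exp (-(4 * (a * t))) := by gcongr
    _ = Real.exp (Λ / a - 3 * (a * t)) := by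
        rw [← Real.exp_add, ← Real.exp_add]; congr 1; ring
    _ ≤ _ := Real.exp_le_exp.2 (by linarith)

end Bounds

/-! ### Choice of constants and the typical formula -/

section Main

variable {k n : ℕ}

/-- All but an `exp (-y)` fraction of the variables are frozen, and the components of the formula
induced by the other variables are of logarithmic size. -/
def IsTypical (y : ℝ) (F : Formula n) : Prop :=
  ((unfrozen F).card : ℝ) ≤ Real.exp (-y) * n ∧
    ∀ φ : Assignment n, ∀ K : (formulaGraph (residual F {x | Frozen F x} φ)).ConnectedComponent,
      (K.supp.ncard : ℝ) ≤ Real.log n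

/-- The bound for the probability of an atypical formula. -/
noncomputable def errorBound (k n : ℕ) : ℝ :=
  2 * (4 * Real.exp (-2)) ^ n + (1 / n + 2 * Real.exp (2 * k) / n)

theorem tendsto_errorBound (k : ℕ) : Tendsto (errorBound k) atTop (𝓝 0) := by
  have he : 4 * Real.exp (-2) < 1 := by
    have h : (4 : ℝ) < Real.exp 2 := by
      have h1 : Real.exp 2 = Real.exp 1 * Real.exp 1 := by rw [← Real.exp_add]; norm_num
      have := Real.exp_one_gt_d9
      rw [h1]; nlinarith
    rw [Real.exp_neg, ← div_eq_mul_inv, div_lt_one (Real.exp_pos _)]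
    exact h
  have h1 := (tendsto_pow_atTop_nhds_zero_of_lt_one (by positivity) he).const_mul 2
  have h2 := (tendsto_const_div_atTop_nhds_zero_nat 1).add
    (tendsto_const_div_atTop_nhds_zero_nat (2 * Real.exp (2 * k)))
  have h := h1.add h2
  simp only [mul_zero, add_zero] at h
  exact h

/-- The number of clauses per variable scanned in the first stage. -/
def firstStage (k : ℕ) : ℕ := 8 * 16 ^ k

/-- The exponent in the fraction of variables that are not frozen. -/
noncomputable def rate (k : ℕ) : ℝ := (1 / 16) ^ k / 8

/-- A constant for the number of explorations. -/
noncomputable def explorationConst (k : ℕ) : ℝ := 2 ^ (k + 2) * k * (k * 4 ^ k)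

/-- The least density of scanned clauses that is considered. -/
noncomputable def density (k : ℕ) : ℝ :=
  4 * firstStage k + (1 + 2 * k + explorationConst k / rate k) / rate k

theorem rate_pos (k : ℕ) : 0 < rate k := by unfold rate; positivity

theorem explorationConst_nonneg (k : ℕ) : 0 ≤ explorationConst k := by
  unfold explorationConst; positivity

/-- In the product, `N` cancels between the number of clauses through a variable and the price `2 /
N` of a pin, leaving the `r`-th power of `explorationConst k * t * exp (-(4 * a * t))`, which is at
most `exp (-(2 * k))`. -/
theorem exploration_bound_le {m₀ m r : ℕ} {N : ℝ} (hk : 1 ≤ k) (hn : 0 < n) (hN : 0 < N)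
    (hm₀ : m₀ ≤ m) (ht0 : 0 ≤ (m : ℝ) / n) (hr : (m : ℝ) ≤ 2 * (m - m₀ - r))
    (ht : 2 * k + explorationConst k / rate k ≤ rate k * (m / n))
    (hkr : Real.log n - k ≤ k * r) :
    n * (2 ^ (1 + (k + 1) * r) * (m * (k * 4 ^ k * (N / n)) * k) ^ r *
      ((2 / (N * Real.exp (-((1 / 16) ^ k * (r / n))))) ^ r *
        Real.exp (-((1 / 16) ^ k * (r / n))) ^ (m - m₀))) ≤ 2 * Real.exp (2 * k) / n := by
  have ha0 := rate_pos k
  have hΛ := explorationConst_nonneg k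
  have hn0 : (0 : ℝ) < n := by exact_mod_cast hn
  have hrate : (1 / 16 : ℝ) ^ k = 8 * rate k := by rw [rate]; ring
  rw [hrate]
  generalize rate k = a at *
  have hsub : ((m - m₀ : ℕ) : ℝ) = m - m₀ := Nat.cast_sub hm₀
  obtain ⟨t, htdef⟩ : ∃ t : ℝ, t = m / n := ⟨_, rfl⟩
  rw [← htdef] at ht ht0
  obtain ⟨ρ, hρ⟩ : ∃ ρ, ρ = Real.exp (-(8 * a * (r / n))) := ⟨_, rfl⟩
  have hρ0 : 0 < ρ := hρ ▸ Real.exp_pos _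
  -- Pins cost `r` of the `m - m₀` factors `ρ`; by `hr` at least `m / 2` factors remain.
  have hexp : ρ ^ (m - m₀) / ρ ^ r ≤ Real.exp (-(4 * (a * t))) ^ r := by
    rw [hρ, ← Real.exp_nat_mul, ← Real.exp_nat_mul, ← Real.exp_nat_mul, ← Real.exp_sub, hsub]
    apply Real.exp_le_exp.2
    have h2 : 0 ≤ 4 * a * r / n := by positivity
    have h3 := mul_le_mul_of_nonneg_left hr h2
    have h4 : 4 * a * r / n * m = r * (4 * (a * t)) := by rw [htdef]; ring
    have h5 : 4 * a * r / n * (2 * (m - m₀ - r)) =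
      (m - m₀) * (8 * a * (r / n)) - r * (8 * a * (r / n)) := by ring
    rw [h4, h5] at h3
    linarith
  have hbase := mul_mul_exp_le (Λ := explorationConst k) (s := 2 * k) ha0 hΛ ht (by positivity)
  have hΛt : 2 ^ (k + 1) * (m * (k * 4 ^ k * (N / n)) * k * (2 / N)) =
      explorationConst k * t := by
    rw [htdef, explorationConst]
    field_simp
    ring
  rw [← hρ]
  calc n * (2 ^ (1 + (k + 1) * r) * (m * (k * 4 ^ k * (N / n)) * k) ^ r *
        ((2 / (N * ρ)) ^ r * ρ ^ (m - m₀)))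
      = 2 * n * ((explorationConst k * t) ^ r * (ρ ^ (m - m₀) / ρ ^ r)) := by
        generalize (m * (k * 4 ^ k * (N / n)) * k : ℝ) = M at *
        rw [← hΛt, ← div_div, div_pow (2 / N), mul_pow, mul_pow, pow_add, pow_mul, pow_one]
        ring
    _ ≤ 2 * n * ((explorationConst k * t) ^ r * Real.exp (-(4 * (a * t))) ^ r) := by
        gcongr
    _ = 2 * n * (explorationConst k * t * Real.exp (-(4 * (a * t)))) ^ r := by
        rw [mul_pow (explorationConst k * t)]
    _ ≤ 2 * n * Real.exp (-(2 * k)) ^ r := by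
        gcongr
    -- By `hkr`, `k * r` falls short of `log n` by at most `k`. The factor `n ^ (-2)` beats the `n`
    -- starting points.
    _ ≤ 2 * n * Real.exp (2 * k - 2 * Real.log n) := by
        rw [← Real.exp_nat_mul]
        gcongr
        linarith
    _ = 2 * Real.exp (2 * k) / n := by
        rw [Real.exp_sub, show 2 * Real.log n = Real.log n + Real.log n by ring,
          Real.exp_add, Real.exp_log hn0]
        field_simp

/-- `firstStage` is chosen so that its product with `(1 / 16) ^ k / 4` is `2`; then `exp (-2) < 1 /
4` beats the `4 ^ n` of the union bound. -/
theorem prob_first_stage_le (hk : 1 ≤ k) (hn : 8 * k ≤ n)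
    (hm : 2 * (firstStage k * n) ≤ Fintype.card (KClause k n)) :
    prob (fun σ : ClauseOrder k n => n ≤ 4 * (unfrozen (satProcess (firstStage k * n) σ)).card) ≤
      2 * (4 * Real.exp (-2)) ^ n := by
  refine (prob_le_card_unfrozen_le hk hn hm).trans (le_of_eq ?_)
  have h : Real.exp (-((1 / 16) ^ k / 4)) ^ firstStage k = Real.exp (-2) := by
    rw [← Real.exp_nat_mul, firstStage]
    congr 1
    push_cast
    rw [one_div, inv_pow]
    field_simp
    norm_num
  rw [pow_mul, h, mul_pow, mul_assoc]

set_option maxHeartbeats 1000000 in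
theorem prob_not_isTypical_le (hk : 1 ≤ k) (hn : 8 * k ≤ n) {m : ℕ}
    (hmn : density k ≤ m / n) (hm : 2 * m ≤ Fintype.card (KClause k n)) :
    prob (fun σ : ClauseOrder k n => ¬ IsTypical (rate k * (m / n)) (satProcess m σ)) ≤
      errorBound k n := by
  classical
  have hA := fun h => prob_first_stage_le (k := k) (n := n) hk hn h
  obtain ⟨m₀, hm₀def⟩ : ∃ m₀, m₀ = firstStage k * n := ⟨_, rfl⟩
  rw [← hm₀def] at hA
  set a := rate k with ha
  set t : ℝ := m / n with ht
  set N := Fintype.card (KClause k n) with hN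
  have hn' : 0 < n := by omega
  have hn0 : (0 : ℝ) < n := by exact_mod_cast hn'
  have hn1 : (1 : ℝ) ≤ n := by exact_mod_cast hn'
  have hk0 : (0 : ℝ) < k := by exact_mod_cast hk
  have ha0 : 0 < a := rate_pos k
  have hΛ := explorationConst_nonneg k
  have hfs : (1 : ℝ) ≤ firstStage k := by
    have : 1 ≤ firstStage k := Nat.mul_pos (by norm_num) (by positivity)
    exact_mod_cast this
  have hpos : 0 ≤ (1 + 2 * k + explorationConst k / a) / a := by positivity
  -- The first summand of `density` makes the first stage at most a quarter of all steps; the second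
  -- makes `a * t` large enough for the numerical bounds.
  have ht1 : 4 * (firstStage k : ℝ) ≤ t := by
    have := hmn; unfold density at this; linarith
  have ht2 : 1 + 2 * k + explorationConst k / a ≤ a * t := by
    have : (1 + 2 * k + explorationConst k / a) / a ≤ t := by
      have := hmn; unfold density at this; linarith
    rw [div_le_iff₀ ha0] at this
    linarith
  have hmt : (m : ℝ) = t * n := by rw [ht]; field_simp
  have h4m₀ : 4 * (m₀ : ℝ) ≤ m := by
    rw [hmt, hm₀def]; push_cast; nlinarith
  have h4n : 4 * (n : ℝ) ≤ m := by rw [hmt]; nlinarith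
  have hm₀ : m₀ ≤ m := by
    have : (m₀ : ℝ) ≤ m := by
      have : (0 : ℝ) ≤ m₀ := by positivity
      linarith
    exact_mod_cast this
  have hsub : ((m - m₀ : ℕ) : ℝ) = m - m₀ := Nat.cast_sub hm₀
  have hrate : (1 / 16 : ℝ) ^ k = 8 * a := by rw [ha, rate]; ring
  have hat1 : 1 ≤ a * t := by
    have : 0 ≤ explorationConst k / a := by positivity
    linarith
  -- `b` is the least number of unfrozen variables that violates the claim, and `r` is the largest
  -- number of clauses with `k * r ≤ log n`.
  obtain ⟨b, hb⟩ : ∃ b, b = ⌊Real.exp (-(a * t)) * n⌋₊ + 1 := ⟨_, rfl⟩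
  obtain ⟨r, hr⟩ : ∃ r, r = ⌊Real.log n / k⌋₊ := ⟨_, rfl⟩
  have hlog0 : 0 ≤ Real.log n := Real.log_nonneg hn1
  have hkr : (k * r : ℝ) ≤ Real.log n := by
    have := Nat.floor_le (div_nonneg hlog0 hk0.le)
    rw [← hr, le_div_iff₀ hk0] at this
    linarith
  have hkr' : Real.log n - k ≤ k * r := by
    have := (Nat.lt_floor_add_one (Real.log n / k)).le
    rw [← hr, div_le_iff₀ hk0] at this
    linarith
  have hrn : (r : ℝ) ≤ n := by
    have h1 : Real.log n ≤ n := by linarith [Real.log_le_sub_one_of_pos hn0]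
    have h2 : (1 : ℝ) ≤ k := by exact_mod_cast hk
    have h3 : (0 : ℝ) ≤ r := by positivity
    nlinarith
  have hA := hA (by omega)
  have hB : prob (fun σ : ClauseOrder k n => 4 * (unfrozen (satProcess m₀ σ)).card < n ∧
      b ≤ (unfrozen (satProcess m σ)).card) ≤ 1 / n := by
    refine (prob_le_card_unfrozen_le_choose hk hn hm₀ hm b).trans ?_
    have hblt : Real.exp (-(a * t)) * n < b := by
      rw [hb]; push_cast; exact Nat.lt_floor_add_one _
    refine le_trans (le_of_eq ?_) (choose_mul_exp_le_one_div (D := m - m₀) hn' hat1 hblt ?_)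
    · rw [← Real.exp_nat_mul, hsub, hrate]
      congr 2; ring
    · have : 6 * (a * t) * n = 6 * a * m := by rw [hmt]; ring
      rw [this]
      nlinarith
  have hNpos : (0 : ℝ) < N := by
    have : (2 * m : ℝ) ≤ N := by exact_mod_cast hm
    linarith
  have hC : prob (fun σ : ClauseOrder k n => 4 * (unfrozen (satProcess m₀ σ)).card < n ∧
      ∃ φ, ∃ K : (formulaGraph (residual (satProcess m σ) {x | Frozen (satProcess m σ) x}
        φ)).ConnectedComponent, 1 + k * r < K.supp.ncard + k) ≤ 2 * Real.exp (2 * k) / n := by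
    set M : ℝ := m * (k * 4 ^ k * (N / n)) * k with hMdef
    have h1k : (1 : ℝ) ≤ k := by exact_mod_cast hk
    have hM : 1 ≤ M := by
      have h1 : M = t * (k * k) * 4 ^ k * N := by rw [hMdef, ht]; ring
      have h2 : (1 : ℝ) ≤ t := by linarith
      have h3 : (1 : ℝ) ≤ N := by linarith [show (2 * m : ℝ) ≤ N by exact_mod_cast hm]
      have h4 : (1 : ℝ) ≤ 4 ^ k := one_le_pow₀ (by norm_num)
      have h5 : (1 : ℝ) ≤ k * k := by nlinarith
      rw [h1]
      exact one_le_mul_of_one_le_of_one_le (one_le_mul_of_one_le_of_one_le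
        (one_le_mul_of_one_le_of_one_le h2 h5) h4) h3
    refine (prob_exists_component_le hk hn hm₀ hm r hM fun u => ?_).trans ?_
    · rw [hMdef]
      gcongr
      exact card_clausesAt_le_real hk (by omega) u
    · have hle : (m : ℝ) ≤ 2 * (m - m₀ - r) := by linarith
      have htd : 2 * k + explorationConst k / rate k ≤ rate k * (m / n) := by
        rw [← ha, ← ht]; linarith
      exact exploration_bound_le hk hn' hNpos hm₀ (by positivity) hle htd hkr'
  refine le_trans (prob_mono (E' := fun σ : ClauseOrder k n =>
    n ≤ 4 * (unfrozen (satProcess m₀ σ)).card ∨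
    ((4 * (unfrozen (satProcess m₀ σ)).card < n ∧ b ≤ (unfrozen (satProcess m σ)).card) ∨
    (4 * (unfrozen (satProcess m₀ σ)).card < n ∧
      ∃ φ, ∃ K : (formulaGraph (residual (satProcess m σ) {x | Frozen (satProcess m σ) x}
        φ)).ConnectedComponent, 1 + k * r < K.supp.ncard + k))) ?_)
    ((prob_or_le _ _).trans (add_le_add hA ((prob_or_le _ _).trans (add_le_add hB hC))))
  intro σ hσ
  by_cases h0 : n ≤ 4 * (unfrozen (satProcess m₀ σ)).card
  · exact Or.inl h0
  refine Or.inr ?_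
  rw [not_le] at h0
  by_contra! hcon
  refine hσ ⟨?_, fun φ K => ?_⟩
  · have h1 := hcon.1 h0
    have h2 : (unfrozen (satProcess m σ)).card ≤ ⌊Real.exp (-(a * t)) * n⌋₊ := by omega
    exact (Nat.le_floor_iff (by positivity)).1 h2
  · have h1 := hcon.2 h0 φ K
    by_contra! hlt
    have h2 : (k * r : ℝ) < K.supp.ncard := lt_of_le_of_lt hkr hlt
    have h3 : k * r < K.supp.ncard := by exact_mod_cast h2
    omega

theorem IsTypical.of_unfrozen_eq_empty {y : ℝ} {m : ℕ} {σ : ClauseOrder k n} (hn : 3 ≤ n)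
    (h : unfrozen (satProcess m σ) = ∅) : IsTypical y (satProcess m σ) := by
  refine ⟨by rw [h]; simp; positivity, fun φ K => ?_⟩
  have hlog : (1 : ℝ) ≤ Real.log n := by
    rw [Real.le_log_iff_exp_le (by positivity)]
    have h1 := Real.exp_one_lt_d9
    have h2 : (3 : ℝ) ≤ n := by exact_mod_cast hn
    linarith
  refine le_trans ?_ hlog
  by_contra! hlt
  have hlt' : 1 < K.supp.ncard := by exact_mod_cast hlt
  obtain ⟨x₀, R, -, hlen, hall, -⟩ := exists_exploration_of_component K (r := 1) (by omega)
  obtain ⟨e, rfl⟩ := List.length_eq_one_iff.1 hlen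
  have := (hall e (by simp)).2.1
  rw [h] at this
  simp at this

/-- Two satisfying assignments that agree on the unfrozen variables are equal. -/
theorem numSat_le (F : Formula n) : numSat F ≤ 2 ^ (unfrozen F).card := by
  classical
  rw [numSat, Set.ncard_eq_toFinset_card']
  have h : ((Finset.univ.filter fun φ : Assignment n => Satisfies φ F)).card ≤
      Fintype.card (unfrozen F → Bool) := by
    rw [← Finset.card_univ]
    refine Finset.card_le_card_of_injOn (fun φ x => φ x) (fun _ _ => Finset.mem_univ _) ?_
    intro φ hφ ψ hψ heq
    funext x
    by_cases hx : x ∈ unfrozen F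
    · exact congrFun heq ⟨x, hx⟩
    · rw [mem_unfrozen, not_not] at hx
      exact hx φ ψ (by simpa using hφ) (by simpa using hψ)
  rw [Set.toFinset_ofPred]
  simpa using h

theorem one_le_numSat {F : Formula n} (hF : Satisfiable F) : 1 ≤ numSat F :=
  Nat.one_le_iff_ne_zero.2 (((Set.ncard_pos (Set.toFinite _)).2 hF).ne')

theorem IsTypical.log_numSat_le {y : ℝ} {F : Formula n} (hn : 0 < n) (hF : Satisfiable F)
    (h : IsTypical y F) : 1 / (n : ℝ) * Real.log (numSat F) ≤ Real.exp (-y) := by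
  have hn0 : (0 : ℝ) < n := by exact_mod_cast hn
  have h1 : Real.log (numSat F) ≤ (unfrozen F).card := by
    have h2 : (numSat F : ℝ) ≤ 2 ^ (unfrozen F).card := by exact_mod_cast numSat_le F
    have h3 : (0 : ℝ) < numSat F := by exact_mod_cast one_le_numSat hF
    have h4 := Real.log_le_log h3 h2
    rw [Real.log_pow] at h4
    have h5 : Real.log 2 ≤ 1 := by linarith [Real.log_two_lt_d9]
    have h6 : (0 : ℝ) ≤ (unfrozen F).card := by positivity
    nlinarith
  rw [one_div, ← div_eq_inv_mul, div_le_iff₀ hn0]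
  exact h1.trans h.1

/-- At half of all clauses the bound on unfrozen variables is below `1`, so there are none. This
persists for all later `m`, and typicality then holds with any exponent `y'`. -/
theorem prob_not_isTypical_le_of_large (hk : 1 ≤ k) (hn : 8 * k ≤ n) (hn3 : 3 ≤ n) {m : ℕ}
    (hm : Fintype.card (KClause k n) < 2 * m) {y y' : ℝ} (hy : density k ≤ y)
    (hyN : y ≤ (Fintype.card (KClause k n) / 2 : ℕ) / n)
    (hexp : Real.exp (-(rate k * y)) * n < 1) :
    prob (fun σ : ClauseOrder k n => ¬ IsTypical y' (satProcess m σ)) ≤ errorBound k n := by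
  refine le_trans (prob_mono fun σ hσ h => ?_)
    (prob_not_isTypical_le (m := Fintype.card (KClause k n) / 2) hk hn (hy.trans hyN)
      (Nat.mul_div_le _ _))
  refine hσ (IsTypical.of_unfrozen_eq_empty hn3 ?_)
  have h1 : ((unfrozen (satProcess (Fintype.card (KClause k n) / 2) σ)).card : ℝ) < 1 := by
    refine h.1.trans_lt (lt_of_le_of_lt ?_ hexp)
    have := rate_pos k
    gcongr
  have h2 : (unfrozen (satProcess (Fintype.card (KClause k n) / 2) σ)).card = 0 := by
    have : (unfrozen (satProcess (Fintype.card (KClause k n) / 2) σ)).card < 1 := by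
      exact_mod_cast h1
    omega
  rw [Finset.card_eq_zero] at h2
  rw [← Finset.subset_empty, ← h2]
  exact unfrozen_anti (satProcess_mono (by omega) σ)

theorem eventually_le_card_kClause_div (hk : 2 ≤ k) :
    ∀ᶠ n : ℕ in atTop, ∃ y, density k ≤ y ∧
      y ≤ (Fintype.card (KClause k n) / 2 : ℕ) / n ∧ Real.exp (-(rate k * y)) * n < 1 := by
  set A : ℝ := 1 / (8 * k.factorial) with hA
  have hA0 : 0 < A := by positivity
  have hr := rate_pos k
  have hlin : Tendsto (fun n : ℕ => A * (n : ℝ)) atTop atTop :=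
    tendsto_natCast_atTop_atTop.const_mul_atTop hA0
  have h1 : ∀ᶠ n : ℕ in atTop, density k + 1 ≤ A * n := hlin.eventually_ge_atTop _
  have h2 : Tendsto (fun n : ℕ => (rate k * (A * n)) ^ 1 * Real.exp (-(rate k * (A * n)))) atTop
      (𝓝 0) :=
    (Real.tendsto_pow_mul_exp_neg_atTop_nhds_zero 1).comp (hlin.const_mul_atTop hr)
  have h3 := h2.eventually (gt_mem_nhds
    (show (0 : ℝ) < rate k * A * Real.exp (-(rate k)) by positivity))
  filter_upwards [h1, h3, eventually_ge_atTop (2 * k)] with n h1 h3 hn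
  -- Half of the bound `(n / 2) ^ 2 / k!` is `A * n * n`, so `N / (2 * n)` is at least `A * n`; the
  -- `- 1` absorbs the rounding of `N / 2`.
  refine ⟨A * n - 1, by linarith, ?_, ?_⟩
  · have hn0 : (0 : ℝ) < n := by
      have : 0 < n := by omega
      exact_mod_cast this
    have hn1 : (1 : ℝ) ≤ n / 2 := by
      have : (2 : ℝ) ≤ n := by
        have : 2 ≤ n := by omega
        exact_mod_cast this
      linarith
    have h4 := le_card_kClause (k := k) hn
    have h5 : (n / 2 : ℝ) ^ 2 ≤ (n / 2 : ℝ) ^ k := pow_le_pow_right₀ hn1 hk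
    have h6 : (Fintype.card (KClause k n) : ℝ) / 2 - 1 ≤ (Fintype.card (KClause k n) / 2 : ℕ) := by
      have : Fintype.card (KClause k n) ≤ 2 * (Fintype.card (KClause k n) / 2) + 2 := by omega
      have : (Fintype.card (KClause k n) : ℝ) ≤
          2 * (Fintype.card (KClause k n) / 2 : ℕ) + 2 := by exact_mod_cast this
      linarith
    rw [le_div_iff₀ hn0]
    have h7 : (n / 2 : ℝ) ^ 2 / k.factorial ≤ Fintype.card (KClause k n) :=
      le_trans (by gcongr) h4
    have h8 : (n / 2 : ℝ) ^ 2 / k.factorial / 2 = A * n * n := by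
      rw [hA]; field_simp; ring
    linarith
  · have h4 : Real.exp (-(rate k * (A * n - 1))) =
        Real.exp (-(rate k * (A * n))) * Real.exp (rate k) := by
      rw [← Real.exp_add]; congr 1; ring
    rw [h4]
    rw [pow_one, Real.exp_neg (rate k), ← div_eq_mul_inv, lt_div_iff₀ (Real.exp_pos _)] at h3
    have h5 : 0 < rate k * A := by positivity
    refine lt_of_mul_lt_mul_left (a := rate k * A) ?_ h5.le
    calc _ = rate k * (A * n) * Real.exp (-(rate k * (A * n))) * Real.exp (rate k) := by ring
      _ < _ := by linarith

theorem Psat_apply (m : ℕ) (A : Set (Formula n)) :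
    (Psat k n m).toOuterMeasure A =
      ENNReal.ofReal (prob fun σ : ClauseOrder k n => satProcess m σ ∈ A) := by
  classical
  rw [Psat, PMF.toOuterMeasure_map_apply, PMF.toOuterMeasure_uniformOfFintype_apply,
    prob_eq_card, ENNReal.ofReal_div_of_pos (by exact_mod_cast Fintype.card_pos),
    ENNReal.ofReal_natCast, ENNReal.ofReal_natCast, ← Fintype.card_subtype]
  rfl

theorem one_sub_prob_not_le {Ω : Type*} [Fintype Ω] [Nonempty Ω] (E : Ω → Prop) :
    1 - prob (fun ω => ¬ E ω) ≤ prob E := by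
  have h := prob_or_le E fun ω => ¬ E ω
  have h1 : prob (fun ω => E ω ∨ ¬ E ω) = 1 := by
    classical
    rw [prob_eq_card]
    simp [em, Finset.card_univ]
  linarith

end Main

end KSat

theorem theorem1 (k : ℕ) (hk : 1 ≤ k) :
    ∃ c α : ℝ, 0 < c ∧ 0 < α ∧
      ∀ m : ℕ → ℕ,
        (∀ᶠ n : ℕ in atTop, c ≤ (m n : ℝ) / (n : ℝ) ∧ m n ≤ 2 ^ k * n.choose k) →
        Tendsto
          (fun n : ℕ => (KSat.Psat k n (m n)).toOuterMeasure
            {F : KSat.Formula n |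
              -- all but few variables are frozen
              ({x : Fin n | ¬ KSat.Frozen F x}.ncard : ℝ)
                  ≤ Real.exp (-(α * ((m n : ℝ) / (n : ℝ)))) * (n : ℝ) ∧
              -- components of the formula induced by the non-frozen variables
              (∀ φ : KSat.Assignment n, KSat.Satisfies φ F →
                ∀ K : (KSat.formulaGraph
                    (KSat.residual F {x | KSat.Frozen F x} φ)).ConnectedComponent,
                  (K.supp.ncard : ℝ) ≤ Real.log (n : ℝ)) ∧
              -- the number of satisfying assignments
              1 ≤ KSat.numSat F ∧
              1 / (n : ℝ) * Real.log (KSat.numSat F : ℝ)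
                  ≤ Real.exp (-(α * ((m n : ℝ) / (n : ℝ))))})
          atTop (𝓝 1) := by
  have hc : 0 < KSat.density k := by
    have h1 := KSat.rate_pos k
    have h2 := KSat.explorationConst_nonneg k
    unfold KSat.density
    positivity
  refine ⟨KSat.density k, KSat.rate k, hc, KSat.rate_pos k, fun m hm => ?_⟩
  have hbound : ∀ᶠ n : ℕ in atTop,
      KSat.prob (fun σ : KSat.ClauseOrder k n =>
        ¬ KSat.IsTypical (KSat.rate k * ((m n : ℝ) / n)) (KSat.satProcess (m n) σ)) ≤
        KSat.errorBound k n := by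
    rcases hk.eq_or_lt with rfl | hk2
    · -- for `k = 1` there are fewer than `density 1 * n` clauses
      filter_upwards [hm, eventually_gt_atTop 0] with n hmn hn
      have hn0 : (0 : ℝ) < n := by exact_mod_cast hn
      have h1 : (m n : ℝ) ≤ 2 * n := by
        have : m n ≤ 2 * n := by simpa using hmn.2
        exact_mod_cast this
      have h2 : (m n : ℝ) / n ≤ 2 := by rwa [div_le_iff₀ hn0]
      have h3 : (512 : ℝ) ≤ KSat.density 1 := by
        have h1 := KSat.rate_pos 1
        have h2 := KSat.explorationConst_nonneg 1
        have h3 : 0 ≤ (1 + 2 * (1 : ℕ) + KSat.explorationConst 1 / KSat.rate 1) /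
          KSat.rate 1 := by positivity
        unfold KSat.density
        have h4 : (KSat.firstStage 1 : ℝ) = 128 := by norm_num [KSat.firstStage]
        rw [h4]
        linarith
      linarith [hmn.1]
    · filter_upwards [hm, eventually_ge_atTop (8 * k), eventually_ge_atTop 3,
        KSat.eventually_le_card_kClause_div hk2] with n hmn hn hn3 ⟨y, hy1, hy2, hy3⟩
      by_cases h : 2 * m n ≤ Fintype.card (KSat.KClause k n)
      · exact KSat.prob_not_isTypical_le hk hn hmn.1 h
      -- Past half of the clauses, the density `y` at which freezing is complete replaces `m n / n`.
      · exact KSat.prob_not_isTypical_le_of_large hk hn hn3 (not_le.1 h) hy1 hy2 hy3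
  have hlim : Tendsto (fun n => ENNReal.ofReal (1 - KSat.errorBound k n)) atTop (𝓝 1) := by
    have h := ENNReal.tendsto_ofReal ((KSat.tendsto_errorBound k).const_sub 1)
    simpa using h
  refine tendsto_of_tendsto_of_tendsto_of_le_of_le' hlim tendsto_const_nhds ?_ ?_
  · filter_upwards [hbound, eventually_gt_atTop 0] with n hn hn0
    rw [KSat.Psat_apply]
    refine ENNReal.ofReal_le_ofReal ?_
    refine le_trans (by linarith) ((KSat.one_sub_prob_not_le _).trans (KSat.prob_mono ?_))
    intro σ hσ
    have hsat := KSat.satisfiable_satProcess (m n) σ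
    refine ⟨?_, fun φ _ K => hσ.2 φ K, KSat.one_le_numSat hsat,
      KSat.IsTypical.log_numSat_le hn0 hsat hσ⟩
    have : {x : Fin n | ¬ KSat.Frozen (KSat.satProcess (m n) σ) x} =
        (KSat.unfrozen (KSat.satProcess (m n) σ) : Set (Fin n)) := by
      ext x; simp [KSat.mem_unfrozen]
    rw [this, Set.ncard_coe_finset]
    exact hσ.1
  · filter_upwards with n
    rw [KSat.Psat_apply]
    exact ENNReal.ofReal_le_one.2 (KSat.prob_le_one _)
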